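/- Let $(X,\omega)$ be a compact Kähler manifold of complex dimension $n$, $D\subset X$ a smooth divisor with associated holomorphic line bundle $L_D$ and defining section $s$ (so $s$ vanishes exactly on $D$, transversally), $h$ a smooth Hermitian metric on $L_D$ with curvature form $\theta$ ($\theta=-\sqrt{-1}\,\partial\bar\partial\log|\sigma|_h^2$ for a local holomorphic frame $\sigma$), and $\eta$ a smooth closed real $(1,1)$-form. Let $\gamma\in(0,1]$, $\alpha\in(0,1)$, $T>0$. Let $k>0$ be such that $\omega_\gamma=\omega+k\sqrt{-1}\,\partial\bar\partial|s|_h^{2\gamma}$ is positive on $X\setminus D$. Let $h_\gamma\in C^\infty(X)$ be such that, with the volume form $\Omega_\gamma=e^{-h_\gamma}\omega^n$ and $\mathrm{Ric}(\Omega_\gamma)=-\sqrt{-1}\,\partial\bar\partial\log\Omega_\gamma$, the forms $$\omega_{\gamma t}=\omega+t\bigl(-\mathrm{Ric}(\Omega_\gamma)+(1-\gamma)\theta+\eta\bigr)$$ are positive for all $t\in[0,T]$. Consider $$\frac{\partial\varphi}{\partial t}=\log\frac{(\omega_{\gamma t}+\sqrt{-1}\,\partial\bar\partial\varphi)^n}{\omega^n}+h_\gamma+(1-\gamma)\log|s|_h^2.\qquad(*)$$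 Let $C^{2,\alpha,\gamma}(X)$ be Donaldson's space of continuous functions on $X$ that are locally $C^{2,\alpha}$ off $D$ and such that, near each point of $D$, in holomorphic coordinates with $D=\{z_m=0\}$, the function and the components of its $\partial$ and $\partial\bar\partial$ in the coframe $|z_m|^{\gamma-1}dz_m$, $dz_i$ $(i\ne m)$ are $\alpha$-Hölder in the coordinates $|z_m|^{\gamma-1}z_m$, $z_i$ $(i\neq m)$, where for $\gamma<1$ the normal component of $\partial$ and the mixed components of $\partial\bar\partial$ vanish on $D$. For a continuous $\omega$-psh function $u_0$, a family $u(t)\in C^{2,\alpha,\gamma}(X)\cap C^\infty(X\setminus D)$, $t\in(0,T)$, differentiable in $t$ on $(0,T)\times(X\setminus D)$, is a subsolution (respectively supersolution) of $(*)$ with initial value $u_0$ if: 1. for all $0<\delta<T'<T$ there is a constant $C>0$ with $C^{-1}\omega_\gamma\le\omega_{\gamma t}+\sqrt{-1}\,\partial\bar\partial u(t)\le C\omega_\gamma$ on $X\setminus D$ for all $t\in(\delta,T')$; 2. on $(0,T)\times(X\setminus D)$, $\frac{\partial u}{\partial t}$ is $\le$ (respectively $\ge$) the right-hand side of $(*)$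 at $\varphi=u$; 3. $\lim_{t\to0^+}\|u(t)-u_0\|_{L^\infty(X)}=0$. Let $u$ be a subsolution of $(*)$ with initial value $u_0$ and $v$ a supersolution of $(*)$ with initial value $v_0$, where $u_0,v_0\in C^0(X)\cap\mathrm{PSH}(X,\omega)$. Then $$u(t,x)-v(t,x)\le\sup_X(u_0-v_0)\qquad\text{for all }t\in(0,T),\ x\in X.$$ -/

import Mathlib

open scoped Manifold ContDiff Topology ComplexOrder

noncomputable section

namespace ConicalFlow

/-! ### Wirtinger calculus on `ℂⁿ` -/

/-- `∂F/∂z_i = ½ (∂F/∂x_i - √-1 ∂F/∂y_i)`. -/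
def dz {n : ℕ} (i : Fin n) (F : (Fin n → ℂ) → ℂ) (z : Fin n → ℂ) : ℂ :=
  (1 / 2) * (fderiv ℝ F z (Pi.single i 1) - Complex.I * fderiv ℝ F z (Pi.single i Complex.I))

/-- `∂F/∂z̄_i = ½ (∂F/∂x_i + √-1 ∂F/∂y_i)`. -/
def dzbar {n : ℕ} (i : Fin n) (F : (Fin n → ℂ) → ℂ) (z : Fin n → ℂ) : ℂ :=
  (1 / 2) * (fderiv ℝ F z (Pi.single i 1) + Complex.I * fderiv ℝ F z (Pi.single i Complex.I))

/-- The complex Hessian `(∂²f/∂z_i∂z̄_j)`, i.e. the coefficient matrix of `√-1 ∂∂̄ f`. -/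
def complexHessian {n : ℕ} (f : (Fin n → ℂ) → ℝ) (z : Fin n → ℂ) : Matrix (Fin n) (Fin n) ℂ :=
  Matrix.of fun i j => dz i (fun w => dzbar j (fun y => (f y : ℂ)) w) z

/-- Continuous plurisubharmonic functions on a set `U ⊆ ℂⁿ` (sub-mean-value inequality on every
closed complex disc contained in `U`). -/
def IsContinuousPSHOn {n : ℕ} (f : (Fin n → ℂ) → ℝ) (U : Set (Fin n → ℂ)) : Prop :=
  ContinuousOn f U ∧
    ∀ a b : Fin n → ℂ, (∀ ζ : ℂ, ‖ζ‖ ≤ 1 → a + ζ • b ∈ U) →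
      f a ≤ Real.circleAverage (fun ζ : ℂ => f (a + ζ • b)) 0 1

/-! ### Real `(1,1)`-forms on a complex manifold

A form `√-1 ∑ a_{ij̄} dz_i ∧ dz̄_j` is given by its coefficient matrices in the charts of the atlas;
inequalities between real `(1,1)`-forms are inequalities between Hermitian matrices. -/

/-- A smooth real `(1,1)`-form: smooth Hermitian coefficient matrices in each chart of the atlas
with the tensorial transformation rule. The values of `coeff e` outside `e.target`, or for `e`
outside the atlas, are irrelevant. -/
structure RealOneOneForm (n : ℕ) (X : Type*) [TopologicalSpace X]
    [ChartedSpace (Fin n → ℂ) X] where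
  coeff : OpenPartialHomeomorph X (Fin n → ℂ) → (Fin n → ℂ) → Matrix (Fin n) (Fin n) ℂ
  smooth : ∀ e ∈ atlas (Fin n → ℂ) X, ∀ i j,
    ContDiffOn ℝ ∞ (fun z => coeff e z i j) e.target
  hermitian : ∀ e ∈ atlas (Fin n → ℂ) X, ∀ z ∈ e.target, (coeff e z).IsHermitian
  compat : ∀ e ∈ atlas (Fin n → ℂ) X, ∀ e' ∈ atlas (Fin n → ℂ) X,
    ∀ z ∈ e.target, e.symm z ∈ e'.source → ∀ i j,
      coeff e z i j = ∑ k, ∑ l,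
        coeff e' (e' (e.symm z)) k l *
          (fderiv ℂ (fun w => e' (e.symm w)) z (Pi.single i 1) k) *
          (starRingEnd ℂ) (fderiv ℂ (fun w => e' (e.symm w)) z (Pi.single j 1) l)

section Forms

variable {n : ℕ} {X : Type*} [TopologicalSpace X] [ChartedSpace (Fin n → ℂ) X]

/-- `dα = 0`; for a real `(1,1)`-form this is `∂_k a_{ij̄} = ∂_i a_{kj̄}`. -/
def RealOneOneForm.IsClosed (a : RealOneOneForm n X) : Prop :=
  ∀ e ∈ atlas (Fin n → ℂ) X, ∀ z ∈ e.target, ∀ i j k,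
    dz k (fun w => a.coeff e w i j) z = dz i (fun w => a.coeff e w k j) z

/-- Kähler forms: closed and positive. -/
def RealOneOneForm.IsKahler (a : RealOneOneForm n X) : Prop :=
  a.IsClosed ∧ ∀ e ∈ atlas (Fin n → ℂ) X, ∀ z ∈ e.target, (a.coeff e z).PosDef

/-- `f` is (real) `C^∞` on the open set `W ⊆ X`. -/
def SmoothOn (n : ℕ) {X : Type*} [TopologicalSpace X] [ChartedSpace (Fin n → ℂ) X]
    (f : X → ℝ) (W : Set X) : Prop :=
  ∀ e ∈ atlas (Fin n → ℂ) X,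
    ContDiffOn ℝ ∞ (fun z => f (e.symm z)) (e.target ∩ e.symm ⁻¹' W)

/-- `f ∈ C⁰(X) ∩ PSH(X, ωK)`: `f` is continuous, and `ρ + f` is plurisubharmonic for
every local potential `ρ` of `ωK`. -/
def IsContinuousOmegaPSH (ωK : RealOneOneForm n X) (f : X → ℝ) : Prop :=
  Continuous f ∧
    ∀ e ∈ atlas (Fin n → ℂ) X, ∀ U : Set (Fin n → ℂ), IsOpen U → U ⊆ e.target →
      ∀ ρ : (Fin n → ℂ) → ℝ, ContDiffOn ℝ ∞ ρ U →
        (∀ z ∈ U, complexHessian ρ z = ωK.coeff e z) →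
        IsContinuousPSHOn (fun z => ρ z + f (e.symm z)) U

/-- `Ric(Ω) = -√-1 ∂∂̄ log Ω` for the volume form `Ω = e^{-φ} ωK^n`, in the chart `e`. -/
def ricciForm (ωK : RealOneOneForm n X) (φ : X → ℝ)
    (e : OpenPartialHomeomorph X (Fin n → ℂ)) (z : Fin n → ℂ) : Matrix (Fin n) (Fin n) ℂ :=
  -complexHessian (fun w => Real.log (Real.exp (-φ (e.symm w)) * (ωK.coeff e w).det.re)) z

end Forms

/-! ### Hermitian holomorphic line bundles and smooth divisors -/

/-- A smooth Hermitian metric on a line bundle `L`, given by `normSq x ξ = |ξ|_h²`. -/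
structure HermitianMetric (n : ℕ) {X : Type*} [TopologicalSpace X] [ChartedSpace (Fin n → ℂ) X]
    (L : X → Type*) [∀ x, AddCommGroup (L x)] [∀ x, Module ℂ (L x)]
    [∀ x, TopologicalSpace (L x)] [TopologicalSpace (Bundle.TotalSpace ℂ L)]
    [FiberBundle ℂ L] [VectorBundle ℂ ℂ L] where
  normSq : ∀ x, L x → ℝ
  normSq_smul : ∀ (x : X) (c : ℂ) (ξ : L x), normSq x (c • ξ) = ‖c‖ ^ 2 * normSq x ξ
  normSq_pos : ∀ (x : X) (ξ : L x), ξ ≠ 0 → 0 < normSq x ξ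
  smooth : ∀ e ∈ atlas (Fin n → ℂ) X,
    ∀ (τ : Bundle.Trivialization ℂ (Bundle.TotalSpace.proj : Bundle.TotalSpace ℂ L → X))
      [MemTrivializationAtlas τ],
      ContDiffOn ℝ ∞ (fun z => normSq (e.symm z) (τ.symm (e.symm z) 1))
        (e.target ∩ e.symm ⁻¹' τ.baseSet)

section Bundles

variable {n : ℕ} {X : Type*} [TopologicalSpace X] [ChartedSpace (Fin n → ℂ) X]
  {L : X → Type*} [∀ x, AddCommGroup (L x)] [∀ x, Module ℂ (L x)]
  [∀ x, TopologicalSpace (L x)] [TopologicalSpace (Bundle.TotalSpace ℂ L)]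
  [FiberBundle ℂ L] [VectorBundle ℂ ℂ L]

/-- The curvature form `θ = -√-1 ∂∂̄ log |σ|_h²` of `h`, where `σ` is a local holomorphic frame,
in the chart `e`. -/
def curvature (h : HermitianMetric n L)
    (e : OpenPartialHomeomorph X (Fin n → ℂ)) (z : Fin n → ℂ) : Matrix (Fin n) (Fin n) ℂ :=
  -complexHessian (fun w => Real.log
    (h.normSq (e.symm w) ((trivializationAt ℂ L (e.symm z)).symm (e.symm w) 1))) z

/-- `s` is a defining section of the smooth divisor `D`: it is a holomorphic section of `L` whose
zero set is `D` and which vanishes transversally along `D`. Then `L` is the line bundle `L_D`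
associated with `D`. -/
def IsDefiningSection (n : ℕ) {X : Type*} [TopologicalSpace X] [ChartedSpace (Fin n → ℂ) X]
    {L : X → Type*} [∀ x, AddCommGroup (L x)] [∀ x, Module ℂ (L x)]
    [∀ x, TopologicalSpace (L x)] [TopologicalSpace (Bundle.TotalSpace ℂ L)]
    [FiberBundle ℂ L] [VectorBundle ℂ ℂ L] (s : ∀ x, L x) (D : Set X) : Prop :=
  ContMDiff 𝓘(ℂ, Fin n → ℂ) (𝓘(ℂ, Fin n → ℂ).prod 𝓘(ℂ, ℂ)) ω
      (fun x => (Bundle.TotalSpace.mk' ℂ x (s x) : Bundle.TotalSpace ℂ L)) ∧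
    (∀ x, x ∈ D ↔ s x = 0) ∧
    ∀ p ∈ D, fderiv ℂ (fun z => (trivializationAt ℂ L p
        (Bundle.TotalSpace.mk' ℂ ((chartAt (Fin n → ℂ) p).symm z)
          (s ((chartAt (Fin n → ℂ) p).symm z)))).2) (chartAt (Fin n → ℂ) p p) ≠ 0

/-- `ω_γ = ωK + k √-1 ∂∂̄ |s|_h^{2γ}` in the chart `e`. -/
def conicalForm (ωK : RealOneOneForm n X) (h : HermitianMetric n L) (s : ∀ x, L x) (γ k : ℝ)
    (e : OpenPartialHomeomorph X (Fin n → ℂ)) (z : Fin n → ℂ) : Matrix (Fin n) (Fin n) ℂ :=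
  ωK.coeff e z +
    (k : ℂ) • complexHessian (fun w => (h.normSq (e.symm w) (s (e.symm w))) ^ γ) z

/-- `ω_{γt} = ωK + t (-Ric(Ω_γ) + (1-γ) θ + η)` in the chart `e`, where `Ω_γ = e^{-hγ} ωK^n`. -/
def backgroundForm (ωK η : RealOneOneForm n X) (h : HermitianMetric n L) (hγ : X → ℝ) (γ t : ℝ)
    (e : OpenPartialHomeomorph X (Fin n → ℂ)) (z : Fin n → ℂ) : Matrix (Fin n) (Fin n) ℂ :=
  ωK.coeff e z +
    (t : ℂ) • (-ricciForm ωK hγ e z + ((1 - γ : ℝ) : ℂ) • curvature h e z + η.coeff e z)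

/-- `ω_{γt} + √-1 ∂∂̄ f` in the chart `e`. -/
def potentialForm (ωK η : RealOneOneForm n X) (h : HermitianMetric n L) (hγ : X → ℝ) (γ t : ℝ)
    (f : X → ℝ) (e : OpenPartialHomeomorph X (Fin n → ℂ)) (z : Fin n → ℂ) :
    Matrix (Fin n) (Fin n) ℂ :=
  backgroundForm ωK η h hγ γ t e z + complexHessian (fun w => f (e.symm w)) z

/-- The right-hand side
`log ((ω_{γt} + √-1 ∂∂̄ f)^n / ωK^n) + h_γ + (1-γ) log |s|_h²` in the chart `e`. -/
def mongeAmpereRHS (ωK η : RealOneOneForm n X) (h : HermitianMetric n L) (s : ∀ x, L x)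
    (hγ : X → ℝ) (γ t : ℝ) (f : X → ℝ)
    (e : OpenPartialHomeomorph X (Fin n → ℂ)) (z : Fin n → ℂ) : ℝ :=
  Real.log ((potentialForm ωK η h hγ γ t f e z).det.re / (ωK.coeff e z).det.re)
    + hγ (e.symm z) + (1 - γ) * Real.log (h.normSq (e.symm z) (s (e.symm z)))

end Bundles

/-! ### The conical Hölder space `C^{2,α,γ}(X)` -/

/-- The cone coordinates: `z_m` is replaced by `|z_m|^{γ-1} z_m`. -/
def coneCoord {n : ℕ} (γ : ℝ) (m : Fin n) (z : Fin n → ℂ) : Fin n → ℂ :=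
  Function.update z m (((‖z m‖ ^ (γ - 1) : ℝ) : ℂ) * z m)

/-- `F`, defined off `{z_m = 0}`, is `α`-Hölder on `U` in cone coordinates. -/
def ConeHolderOn {n : ℕ} (α γ : ℝ) (m : Fin n) (F : (Fin n → ℂ) → ℂ)
    (U : Set (Fin n → ℂ)) : Prop :=
  ∃ C : ℝ, ∀ z ∈ U, ∀ w ∈ U, z m ≠ 0 → w m ≠ 0 →
    ‖F z - F w‖ ≤ C * ‖coneCoord γ m z - coneCoord γ m w‖ ^ α

/-- `F` tends to `0` along `{z_m = 0}`. -/
def VanishesAlong {n : ℕ} (m : Fin n) (F : (Fin n → ℂ) → ℂ) (U : Set (Fin n → ℂ)) : Prop :=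
  ∀ p ∈ U, p m = 0 → Filter.Tendsto F (𝓝[{z | z m ≠ 0}] p) (𝓝 0)

/-- The factor which turns the coefficient of `dz_i` into the coefficient with respect to the cone
coframe `|z_m|^{γ-1} dz_m`, `dz_i` (`i ≠ m`). -/
def coneWeight {n : ℕ} (γ : ℝ) (m i : Fin n) (z : Fin n → ℂ) : ℂ :=
  if i = m then ((‖z m‖ ^ (1 - γ) : ℝ) : ℂ) else 1

/-- Coefficient of `∂f` in the cone coframe. -/
def coneGrad {n : ℕ} (γ : ℝ) (m i : Fin n) (f : (Fin n → ℂ) → ℝ) (z : Fin n → ℂ) : ℂ :=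
  coneWeight γ m i z * dz i (fun w => (f w : ℂ)) z

/-- Coefficient of `∂∂̄ f` in the cone coframe. -/
def coneHess {n : ℕ} (γ : ℝ) (m i j : Fin n) (f : (Fin n → ℂ) → ℝ) (z : Fin n → ℂ) : ℂ :=
  coneWeight γ m i z * coneWeight γ m j z * complexHessian f z i j

/-- Local condition along `{z_m = 0}`: `f`, `∂f` and `∂∂̄ f` have `α`-Hölder coefficients in
cone coordinates; for `γ < 1` the normal component of `∂f` and the mixed components of `∂∂̄ f`
vanish on `{z_m = 0}`. For `γ = 1` this is the usual Hölder condition on `f, ∂f, ∂∂̄ f`. -/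
def ConeC2On {n : ℕ} (α γ : ℝ) (m : Fin n) (f : (Fin n → ℂ) → ℝ)
    (U : Set (Fin n → ℂ)) : Prop :=
  ContDiffOn ℝ 2 f (U ∩ {z | z m ≠ 0}) ∧
    ConeHolderOn α γ m (fun z => (f z : ℂ)) U ∧
    (∀ i, ConeHolderOn α γ m (coneGrad γ m i f) U) ∧
    (∀ i j, ConeHolderOn α γ m (coneHess γ m i j f) U) ∧
    (γ < 1 → VanishesAlong m (coneGrad γ m m f) U ∧
      ∀ i, i ≠ m → VanishesAlong m (coneHess γ m i m f) U ∧
        VanishesAlong m (coneHess γ m m i f) U)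

/-- `f ∈ C^{2,α,γ}(X)`: `f` is continuous, `C^{2,α}` near points off `D`, and near each point of
`D` it satisfies the conical condition in a holomorphic chart in which `D = {z_m = 0}`. -/
def IsConeC2 (n : ℕ) {X : Type*} [TopologicalSpace X] [ChartedSpace (Fin n → ℂ) X]
    (D : Set X) (α γ : ℝ) (f : X → ℝ) : Prop :=
  Continuous f ∧
    (∀ p ∉ D, ∃ U : Set (Fin n → ℂ), IsOpen U ∧ chartAt (Fin n → ℂ) p p ∈ U ∧
      U ⊆ (chartAt (Fin n → ℂ) p).target ∧
      ContDiffOn ℝ 2 (fun z => f ((chartAt (Fin n → ℂ) p).symm z)) U ∧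
      ∃ C : ℝ, ∀ z ∈ U, ∀ w ∈ U,
        ‖iteratedFDeriv ℝ 2 (fun y => f ((chartAt (Fin n → ℂ) p).symm y)) z -
          iteratedFDeriv ℝ 2 (fun y => f ((chartAt (Fin n → ℂ) p).symm y)) w‖
            ≤ C * ‖z - w‖ ^ α) ∧
    (∀ p ∈ D, ∃ e ∈ IsManifold.maximalAtlas 𝓘(ℂ, Fin n → ℂ) ω X, ∃ m : Fin n,
      p ∈ e.source ∧ (∀ z ∈ e.target, e.symm z ∈ D ↔ z m = 0) ∧
      ∃ U : Set (Fin n → ℂ), IsOpen U ∧ e p ∈ U ∧ U ⊆ e.target ∧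
        ConeC2On α γ m (fun z => f (e.symm z)) U)

/-! ### Sub- and supersolutions -/

section Solutions

variable {n : ℕ} {X : Type*} [TopologicalSpace X] [ChartedSpace (Fin n → ℂ) X]
  {L : X → Type*} [∀ x, AddCommGroup (L x)] [∀ x, Module ℂ (L x)]
  [∀ x, TopologicalSpace (L x)] [TopologicalSpace (Bundle.TotalSpace ℂ L)]
  [FiberBundle ℂ L] [VectorBundle ℂ ℂ L]

/-- The conditions shared by sub- and supersolutions `u` on `(0,T) × X` with initial value `u₀`:
`u₀ ∈ C⁰(X) ∩ PSH(X, ωK)`; `u(t) ∈ C^{2,α,γ}(X) ∩ C^∞(X \ D)` for `t ∈ (0,T)`, and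
`∂u/∂t` exists on `(0,T) × (X \ D)`; for `0 < δ < T' < T` there is `C > 0` with
`C⁻¹ ω_γ ≤ ω_{γt} + √-1 ∂∂̄ u(t) ≤ C ω_γ` on `X \ D` for `t ∈ (δ,T')`;
and `u(t) → u₀` uniformly as `t → 0⁺`. -/
structure IsAdmissible (ωK η : RealOneOneForm n X) (D : Set X) (h : HermitianMetric n L)
    (s : ∀ x, L x) (hγ : X → ℝ) (α γ k T : ℝ) (u₀ : X → ℝ) (u : ℝ → X → ℝ) : Prop where
  initial_psh : IsContinuousOmegaPSH ωK u₀
  regular : ∀ t ∈ Set.Ioo 0 T, IsConeC2 n D α γ (u t) ∧ SmoothOn n (u t) Dᶜ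
  time_diff : ∀ t ∈ Set.Ioo 0 T, ∀ x ∉ D, DifferentiableAt ℝ (fun τ => u τ x) t
  equivalent : ∀ δ T' : ℝ, 0 < δ → δ < T' → T' < T → ∃ C : ℝ, 0 < C ∧
    ∀ t ∈ Set.Ioo δ T', ∀ e ∈ atlas (Fin n → ℂ) X, ∀ z ∈ e.target, e.symm z ∉ D →
      (potentialForm ωK η h hγ γ t (u t) e z -
        ((C⁻¹ : ℝ) : ℂ) • conicalForm ωK h s γ k e z).PosSemidef ∧
      ((C : ℂ) • conicalForm ωK h s γ k e z -
        potentialForm ωK η h hγ γ t (u t) e z).PosSemidef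
  initial : TendstoUniformly u u₀ (𝓝[>] 0)

/-- `u` is a subsolution on `(0,T) × X` with initial value `u₀`. -/
def IsSubsolution (ωK η : RealOneOneForm n X) (D : Set X) (h : HermitianMetric n L)
    (s : ∀ x, L x) (hγ : X → ℝ) (α γ k T : ℝ) (u₀ : X → ℝ) (u : ℝ → X → ℝ) : Prop :=
  IsAdmissible ωK η D h s hγ α γ k T u₀ u ∧
    ∀ t ∈ Set.Ioo 0 T, ∀ e ∈ atlas (Fin n → ℂ) X, ∀ z ∈ e.target, e.symm z ∉ D →
      deriv (fun τ => u τ (e.symm z)) t ≤ mongeAmpereRHS ωK η h s hγ γ t (u t) e z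

/-- `v` is a supersolution on `(0,T) × X` with initial value `v₀`. -/
def IsSupersolution (ωK η : RealOneOneForm n X) (D : Set X) (h : HermitianMetric n L)
    (s : ∀ x, L x) (hγ : X → ℝ) (α γ k T : ℝ) (v₀ : X → ℝ) (v : ℝ → X → ℝ) : Prop :=
  IsAdmissible ωK η D h s hγ α γ k T v₀ v ∧
    ∀ t ∈ Set.Ioo 0 T, ∀ e ∈ atlas (Fin n → ℂ) X, ∀ z ∈ e.target, e.symm z ∉ D →
      mongeAmpereRHS ωK η h s hγ γ t (v t) e z ≤ deriv (fun τ => v τ (e.symm z)) t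

end Solutions

end ConicalFlow

end

/-! The proof is a parabolic maximum principle with a barrier along `D`. The maximum of `u - v` may
sit on `D`, where the equation gives nothing. With `ψ = log|s|² - kC|s|^{2γ}` and small `a > 0`, the
function `u - v + aψ` tends to `-∞` along `D`, so at each time it has a maximum off `D`
(`IsDefiningSection.exists_max_add_barrier`).

Off `D`, `-√-1 ∂∂̄ log|s|²` is the curvature of `h`, which compactness bounds by `Cω`. The term
`kC|s|^{2γ}` turns this into `-√-1 ∂∂̄ψ ≤ Cω_γ`, and `ω_γ ≤ C₂V` with `V = ω_{γt} + √-1 ∂∂̄v`,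
uniformly on compact time intervals. At a maximum point the Hessian of `u - v + aψ` is nonpositive,
so `U = ω_{γt} + √-1 ∂∂̄u` satisfies `U ≤ (1 + aCC₂)V`
(`IsDefiningSection.potentialForm_le_of_max`). Monotonicity of the determinant gives `∂(u - v)/∂t ≤
n log(1 + aCC₂) ≤ naCC₂` there (`deriv_sub_le_of_potentialForm_le`).

The maximum point moves without any continuity in time, and `u`, `v` are not assumed jointly
continuous. The spatial maximum is therefore treated by a one-variable lemma,
`le_add_mul_of_exists_left_slope_le`, which needs only small left difference quotients and a crude
linear growth bound. Letting `a → 0`, then the starting time to `0`, proves the estimate off `D`;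
density of the complement and continuity extend it to `X`. -/

namespace ConicalFlow

open Matrix

/-! ### Hermitian matrices -/

/-- The real part of the sesquilinear form of a matrix on the diagonal. -/
noncomputable def reForm {n : ℕ} (A : Matrix (Fin n) (Fin n) ℂ) (ξ : Fin n → ℂ) : ℝ :=
  (star ξ ⬝ᵥ (A *ᵥ ξ)).re

theorem reForm_add {n : ℕ} (A B : Matrix (Fin n) (Fin n) ℂ) (ξ : Fin n → ℂ) :
    reForm (A + B) ξ = reForm A ξ + reForm B ξ := by
  simp [reForm, add_mulVec, dotProduct_add]

theorem reForm_sub {n : ℕ} (A B : Matrix (Fin n) (Fin n) ℂ) (ξ : Fin n → ℂ) :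
    reForm (A - B) ξ = reForm A ξ - reForm B ξ := by
  simp [reForm, sub_mulVec, dotProduct_sub]

theorem reForm_smul {n : ℕ} (c : ℝ) (A : Matrix (Fin n) (Fin n) ℂ) (ξ : Fin n → ℂ) :
    reForm ((c : ℂ) • A) ξ = c * reForm A ξ := by
  simp [reForm, smul_mulVec]

theorem reForm_smul_vec {n : ℕ} (c : ℝ) (A : Matrix (Fin n) (Fin n) ℂ) (ξ : Fin n → ℂ) :
    reForm A (c • ξ) = c ^ 2 * reForm A ξ := by
  have h : star (c • ξ) = c • star ξ := by ext i; simp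
  rw [reForm, reForm, h, mulVec_smul, smul_dotProduct, dotProduct_smul, Complex.smul_re,
    Complex.smul_re, smul_eq_mul, smul_eq_mul]
  ring

theorem reForm_nonneg {n : ℕ} {A : Matrix (Fin n) (Fin n) ℂ} (hA : A.PosSemidef)
    (ξ : Fin n → ℂ) : 0 ≤ reForm A ξ :=
  hA.re_dotProduct_nonneg ξ

theorem reForm_pos {n : ℕ} {A : Matrix (Fin n) (Fin n) ℂ} (hA : A.PosDef)
    {ξ : Fin n → ℂ} (hξ : ξ ≠ 0) : 0 < reForm A ξ :=
  hA.re_dotProduct_pos hξ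

theorem posSemidef_of_reForm_nonneg {n : ℕ} {A : Matrix (Fin n) (Fin n) ℂ}
    (hA : A.IsHermitian) (h : ∀ ξ, 0 ≤ reForm A ξ) : A.PosSemidef := by
  refine .of_dotProduct_mulVec_nonneg hA fun ξ => ?_
  rw [Complex.le_def]
  exact ⟨h ξ, (hA.im_star_dotProduct_mulVec_self ξ).symm⟩

/-- The eigenvalues of `1 + Q` are values of its form on unit eigenvectors, hence at least `1`, and
the determinant is their product. -/
theorem one_le_det_re_one_add {n : ℕ} {Q : Matrix (Fin n) (Fin n) ℂ} (hQ : Q.PosSemidef) :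
    1 ≤ (1 + Q).det.re := by
  have hH : (1 + Q).IsHermitian := isHermitian_one.add hQ.1
  have hle : ∀ i, 1 ≤ hH.eigenvalues i := fun i => by
    rw [hH.eigenvalues_eq]
    have h0 := hQ.re_dotProduct_nonneg (hH.eigenvectorBasis i)
    have h1 : (star ⇑(hH.eigenvectorBasis i) ⬝ᵥ ⇑(hH.eigenvectorBasis i) : ℂ) = 1 := by
      rw [dotProduct_comm, ← EuclideanSpace.inner_eq_star_dotProduct]
      exact inner_self_eq_one_of_norm_eq_one (hH.eigenvectorBasis.orthonormal.1 i)
    rw [add_mulVec, one_mulVec, dotProduct_add, h1, map_add]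
    simpa using h0
  rw [hH.det_eq_prod_eigenvalues]
  have : ((∏ i, (hH.eigenvalues i : ℂ)) : ℂ) = ((∏ i, hH.eigenvalues i : ℝ) : ℂ) := by
    push_cast; rfl
  erw [this]
  rw [Complex.ofReal_re]
  simpa using Finset.prod_le_prod (s := Finset.univ) (f := fun _ => (1 : ℝ))
    (fun _ _ => zero_le_one) fun i _ => hle i

open scoped MatrixOrder in
/-- The determinant is monotone on positive definite matrices. -/
theorem det_re_le_det_re {n : ℕ} {A B : Matrix (Fin n) (Fin n) ℂ} (hA : A.PosDef)
    (hAB : (B - A).PosSemidef) : A.det.re ≤ B.det.re := by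
  -- Factor `A = GᴴG` with `G` invertible. Then `B = Gᴴ(1 + Q)G` with `Q` positive semidefinite, so
  -- `det B = det A · det(1 + Q)`.
  obtain ⟨G, hG⟩ := CStarAlgebra.nonneg_iff_eq_star_mul_self.mp hA.posSemidef.nonneg
  have hdet : IsUnit G.det := by
    have := hA.det_pos.ne'
    rw [hG, det_mul] at this
    exact (right_ne_zero_of_mul this).isUnit
  set Q := (G⁻¹)ᴴ * (B - A) * G⁻¹ with hQ
  have hQp : Q.PosSemidef := hAB.conjTranspose_mul_mul_same _
  have hB : B = Gᴴ * (1 + Q) * G := by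
    have h1 : G⁻¹ * G = 1 := nonsing_inv_mul _ hdet
    have h2 : Gᴴ * (G⁻¹)ᴴ = 1 := by rw [← conjTranspose_mul, h1, conjTranspose_one]
    have h3 : Gᴴ * Q * G = B - A := by
      calc Gᴴ * Q * G = (Gᴴ * (G⁻¹)ᴴ) * (B - A) * (G⁻¹ * G) := by
            rw [hQ]; simp only [Matrix.mul_assoc]
        _ = B - A := by rw [h1, h2, Matrix.one_mul, Matrix.mul_one]
    rw [Matrix.mul_add, Matrix.add_mul, h3, Matrix.mul_one]
    have : Gᴴ * G = A := hG.symm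
    rw [this]; abel
  have hA0 := Complex.pos_iff.mp hA.det_pos
  have hdB : B.det = A.det * (1 + Q).det := by
    rw [hB, hG, star_eq_conjTranspose, det_mul, det_mul, det_mul]; ring
  rw [hdB, Complex.mul_re, ← hA0.2, zero_mul, sub_zero]
  exact le_mul_of_one_le_right hA0.1.le (one_le_det_re_one_add hQp)

/-- If `U ≤ c V` then `log det U - log det V ≤ n log c`. -/
theorem log_det_sub_log_det_le {n : ℕ} {U V W : Matrix (Fin n) (Fin n) ℂ} (hU : U.PosDef)
    (hV : V.PosDef) (hW : W.PosDef) {c : ℝ} (hc : 0 < c)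
    (h : ((c : ℂ) • V - U).PosSemidef) :
    Real.log (U.det.re / W.det.re) - Real.log (V.det.re / W.det.re) ≤ n * Real.log c := by
  have hU0 := (Complex.pos_iff.mp hU.det_pos).1
  have hV0 := (Complex.pos_iff.mp hV.det_pos).1
  have hW0 := (Complex.pos_iff.mp hW.det_pos).1
  have hle := det_re_le_det_re hU h
  have hd : ((c : ℂ) • V).det.re = c ^ n * V.det.re := by
    rw [det_smul, Fintype.card_fin, ← Complex.ofReal_pow, Complex.re_ofReal_mul]
  rw [hd] at hle
  rw [Real.log_div hU0.ne' hW0.ne', Real.log_div hV0.ne' hW0.ne']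
  have := Real.log_le_log hU0 hle
  rw [Real.log_mul (by positivity) hV0.ne', Real.log_pow] at this
  linarith

/-! ### The Levi form -/

/-- `D²f(η,η) + D²f(√-1 η, √-1 η)`. -/
noncomputable def leviForm {n : ℕ} (f : (Fin n → ℂ) → ℝ) (z η : Fin n → ℂ) : ℝ :=
  fderiv ℝ (fderiv ℝ f) z η η +
    fderiv ℝ (fderiv ℝ f) z (Complex.I • η) (Complex.I • η)

theorem differentiableAt_fderiv_of_contDiffAt {n : ℕ} {f : (Fin n → ℂ) → ℝ} {z : Fin n → ℂ}
    (hf : ContDiffAt ℝ 2 f z) : DifferentiableAt ℝ (fderiv ℝ f) z :=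
  (hf.fderiv_right (m := 1) (by norm_num)).differentiableAt (by norm_num)

theorem eventually_differentiableAt {n : ℕ} {f : (Fin n → ℂ) → ℝ} {z : Fin n → ℂ}
    (hf : ContDiffAt ℝ 2 f z) : ∀ᶠ w in 𝓝 z, DifferentiableAt ℝ f w :=
  (hf.eventually (by simp)).mono fun _ h => h.differentiableAt (by norm_num)

theorem leviForm_congr {n : ℕ} {f g : (Fin n → ℂ) → ℝ} {z : Fin n → ℂ} (h : f =ᶠ[𝓝 z] g)
    (η : Fin n → ℂ) : leviForm f z η = leviForm g z η := by
  rw [leviForm, leviForm, h.fderiv.fderiv_eq]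

theorem leviForm_add {n : ℕ} {f g : (Fin n → ℂ) → ℝ} {z : Fin n → ℂ}
    (hf : ContDiffAt ℝ 2 f z) (hg : ContDiffAt ℝ 2 g z) (η : Fin n → ℂ) :
    leviForm (fun w => f w + g w) z η = leviForm f z η + leviForm g z η := by
  have h : fderiv ℝ (fun w => f w + g w) =ᶠ[𝓝 z] fun w => fderiv ℝ f w + fderiv ℝ g w := by
    filter_upwards [eventually_differentiableAt hf, eventually_differentiableAt hg] with w h1 h2
    exact fderiv_fun_add h1 h2
  rw [leviForm, h.fderiv_eq, fderiv_fun_add (differentiableAt_fderiv_of_contDiffAt hf) (differentiableAt_fderiv_of_contDiffAt hg)]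
  simp only [leviForm, _root_.add_apply]
  ring

theorem leviForm_const_mul {n : ℕ} {f : (Fin n → ℂ) → ℝ} {z : Fin n → ℂ}
    (hf : ContDiffAt ℝ 2 f z) (c : ℝ) (η : Fin n → ℂ) :
    leviForm (fun w => c * f w) z η = c * leviForm f z η := by
  have h : fderiv ℝ (fun w => c * f w) =ᶠ[𝓝 z] fun w => c • fderiv ℝ f w := by
    filter_upwards [eventually_differentiableAt hf] with w h1
    exact fderiv_const_mul h1 c
  rw [leviForm, h.fderiv_eq, fderiv_fun_const_smul (differentiableAt_fderiv_of_contDiffAt hf)]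
  simp only [leviForm, _root_.smul_apply, smul_eq_mul]
  ring

/-- The diagonal of the complex Hessian is a quarter of the Levi form. -/
theorem reForm_complexHessian {n : ℕ} {f : (Fin n → ℂ) → ℝ} {z : Fin n → ℂ}
    (hf : ContDiffAt ℝ 2 f z) (ξ : Fin n → ℂ) :
    reForm (complexHessian f z) ξ = (1 / 4) * leviForm f z (star ξ) := by
  set B := fderiv ℝ (fderiv ℝ f) z with hB
  have hfd : ∀ᶠ w in 𝓝 z, ∀ e, fderiv ℝ (fun y => (f y : ℂ)) w e = (fderiv ℝ f w e : ℂ) := by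
    filter_upwards [eventually_differentiableAt hf] with w hw e
    have := (Complex.ofRealCLM.hasFDerivAt.comp w hw.hasFDerivAt).fderiv
    have h2 : (fun y => (f y : ℂ)) = Complex.ofRealCLM ∘ f := rfl
    rw [h2, this]; rfl
  have happ : ∀ e : Fin n → ℂ, HasFDerivAt (fun w => ((fderiv ℝ f w e : ℝ) : ℂ))
      (Complex.ofRealCLM.comp (B.flip e)) z := fun e => by
    have h1 : HasFDerivAt (fun w => fderiv ℝ f w e) (B.flip e) z := by
      have := (differentiableAt_fderiv_of_contDiffAt hf).hasFDerivAt.clm_apply (hasFDerivAt_const e z)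
      simpa using this
    exact Complex.ofRealCLM.hasFDerivAt.comp z h1
  have hbar : ∀ j, (fun w => dzbar j (fun y => (f y : ℂ)) w) =ᶠ[𝓝 z] fun w =>
      (1 / 2) * ((fderiv ℝ f w (Pi.single j 1) : ℂ) +
        Complex.I * (fderiv ℝ f w (Pi.single j Complex.I) : ℂ)) := fun j => by
    filter_upwards [hfd] with w hw
    simp only [dzbar, hw]
  have hH : ∀ i j, complexHessian f z i j = (1 / 4) *
      (((B (Pi.single i 1) (Pi.single j 1) + B (Pi.single i Complex.I) (Pi.single j Complex.I) : ℝ)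
        : ℂ) + Complex.I * ((B (Pi.single i 1) (Pi.single j Complex.I) -
          B (Pi.single i Complex.I) (Pi.single j 1) : ℝ) : ℂ)) := fun i j => by
    have hd := (((happ (Pi.single j 1)).add ((happ (Pi.single j Complex.I)).const_mul
      Complex.I)).const_mul (1 / 2)).fderiv
    simp only [complexHessian, Matrix.of_apply, dz]
    rw [(hbar j).fderiv_eq]
    erw [hd]
    simp
    linear_combination (-1 / 4 : ℂ) *
      (B (Pi.single i Complex.I) (Pi.single j Complex.I) : ℂ) * Complex.I_mul_I
  have hdec : ∀ η : Fin n → ℂ, η = ∑ i, ((η i).re • (Pi.single i 1 : Fin n → ℂ) +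
      (η i).im • (Pi.single i Complex.I : Fin n → ℂ)) := fun η => by
    ext j
    rw [Finset.sum_apply, Finset.sum_eq_single j]
    · simpa [mul_comm] using (Complex.re_add_im (η j)).symm
    · intro b _ hb; simp [hb.symm]
    · simp
  have hBq : ∀ η : Fin n → ℂ, B η η = ∑ i, ∑ j,
      ((η i).re * (η j).re * B (Pi.single i 1) (Pi.single j 1) +
        (η i).re * (η j).im * B (Pi.single i 1) (Pi.single j Complex.I) +
        (η i).im * (η j).re * B (Pi.single i Complex.I) (Pi.single j 1) +
        (η i).im * (η j).im * B (Pi.single i Complex.I) (Pi.single j Complex.I)) := fun η => by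
    conv_lhs => rw [hdec η]
    rw [map_sum B, _root_.sum_apply]
    refine Finset.sum_congr rfl fun i _ => ?_
    rw [map_sum]
    refine Finset.sum_congr rfl fun j _ => ?_
    simp only [map_add, map_smul, _root_.add_apply, _root_.smul_apply, smul_eq_mul]
    ring
  -- The matrix form pairs the `(i, j)` entry with `conj (ξ i) * ξ j`, whereas `∂_i ∂̄_j` belongs to
  -- `η i * conj (η j)`; hence `η = star ξ`. The two sides agree for each pair `(i, j)`, so symmetry
  -- of `B` is not needed.
  rw [leviForm, ← hB, hBq, hBq, ← Finset.sum_add_distrib, Finset.mul_sum, reForm, dotProduct,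
    Complex.re_sum]
  refine Finset.sum_congr rfl fun i _ => ?_
  rw [← Finset.sum_add_distrib, Finset.mul_sum, mulVec, dotProduct, Finset.mul_sum, Complex.re_sum]
  refine Finset.sum_congr rfl fun j _ => ?_
  rw [hH]
  simp
  ring

/-- The second derivative is nonpositive at a local maximum. -/
theorem deriv_deriv_nonpos_of_isLocalMax {φ : ℝ → ℝ} {a : ℝ} (hc : ContinuousAt φ a)
    (h : IsLocalMax φ a) : deriv (deriv φ) a ≤ 0 := by
  by_contra! hpos
  -- A positive second derivative would make `a` a local minimum too, so `φ` would be constant near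
  -- `a`.
  have hmin := isLocalMin_of_deriv_deriv_pos hpos h.deriv_eq_zero hc
  have heq : φ =ᶠ[𝓝 a] fun _ => φ a := by
    filter_upwards [h, hmin] with x h1 h2 using le_antisymm h1 h2
  have h1 : deriv φ =ᶠ[𝓝 a] fun _ => 0 := by
    filter_upwards [heq.deriv] with x hx
    simp [hx]
  rw [h1.deriv_eq] at hpos
  simp at hpos

theorem fderiv_fderiv_nonpos_of_isLocalMax {n : ℕ} {f : (Fin n → ℂ) → ℝ} {z : Fin n → ℂ}
    (hf : ContDiffAt ℝ 2 f z) (h : IsLocalMax f z) (η : Fin n → ℂ) :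
    fderiv ℝ (fderiv ℝ f) z η η ≤ 0 := by
  set l : ℝ → (Fin n → ℂ) := fun s => z + s • η with hl
  have hl0 : l 0 = z := by simp [hl]
  have hld : ∀ s, HasDerivAt l η s := fun s => by
    simpa only [id, one_smul] using ((hasDerivAt_id s).smul_const η).const_add z
  have hlc : Filter.Tendsto l (𝓝 0) (𝓝 z) := by
    simpa [hl0] using (hld 0).continuousAt.tendsto
  have hd1 : deriv (f ∘ l) =ᶠ[𝓝 0] fun s => fderiv ℝ f (l s) η := by
    filter_upwards [hlc.eventually (eventually_differentiableAt hf)] with s hs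
    exact (hs.hasFDerivAt.comp_hasDerivAt s (hld s)).deriv
  have hd2 : deriv (deriv (f ∘ l)) 0 = fderiv ℝ (fderiv ℝ f) z η η := by
    rw [hd1.deriv_eq]
    have h1 : HasFDerivAt (fderiv ℝ f) (fderiv ℝ (fderiv ℝ f) z) (l 0) := by
      rw [hl0]; exact (differentiableAt_fderiv_of_contDiffAt hf).hasFDerivAt
    have := (h1.comp_hasDerivAt 0 (hld 0)).clm_apply (hasDerivAt_const (0 : ℝ) η)
    simpa using this.deriv
  rw [← hd2]
  refine deriv_deriv_nonpos_of_isLocalMax ?_ ?_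
  · exact ContinuousAt.comp (by rw [hl0]; exact hf.continuousAt) (hld 0).continuousAt
  · have := hlc.eventually h
    filter_upwards [this] with s hs
    simpa [hl0] using hs

theorem leviForm_nonpos_of_isLocalMax {n : ℕ} {f : (Fin n → ℂ) → ℝ} {z : Fin n → ℂ}
    (hf : ContDiffAt ℝ 2 f z) (h : IsLocalMax f z) (η : Fin n → ℂ) : leviForm f z η ≤ 0 :=
  add_nonpos (fderiv_fderiv_nonpos_of_isLocalMax hf h _)
    (fderiv_fderiv_nonpos_of_isLocalMax hf h _)

/-- The real part of a holomorphic function is pluriharmonic. -/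
theorem leviForm_re {n : ℕ} {F : (Fin n → ℂ) → ℂ} {z : Fin n → ℂ} (hF : ContDiffAt ℂ 2 F z)
    (η : Fin n → ℂ) : leviForm (fun w => (F w).re) z η = 0 := by
  have h1 : fderiv ℝ (fun w => (F w).re) =ᶠ[𝓝 z] fun w =>
      Complex.reCLM.comp ((fderiv ℂ F w).restrictScalars ℝ) := by
    filter_upwards [hF.eventually (by simp)] with w hw
    have hd := (hw.differentiableAt (by norm_num)).hasFDerivAt.restrictScalars ℝ
    exact (Complex.reCLM.hasFDerivAt.comp w hd).fderiv
  have h2 : DifferentiableAt ℂ (fderiv ℂ F) z :=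
    (hF.fderiv_right (m := 1) (by norm_num)).differentiableAt (by norm_num)
  have h3 : ∀ a b, fderiv ℝ (fderiv ℝ (fun w => (F w).re)) z a b =
      (fderiv ℂ (fderiv ℂ F) z a b).re := fun a b => by
    have hdiff : DifferentiableAt ℝ (fderiv ℝ (fun w => (F w).re)) z := by
      refine differentiableAt_fderiv_of_contDiffAt ?_
      exact Complex.reCLM.contDiff.contDiffAt.comp z (hF.restrict_scalars ℝ)
    have e1 : fderiv ℝ (fun w => fderiv ℝ (fun w => (F w).re) w b) z a =
        fderiv ℝ (fderiv ℝ (fun w => (F w).re)) z a b := by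
      have := (hdiff.hasFDerivAt.clm_apply (hasFDerivAt_const b z)).fderiv
      simpa using congrArg (fun T => T a) this
    have e2 : (fun w => fderiv ℝ (fun w => (F w).re) w b) =ᶠ[𝓝 z]
        fun w => (fderiv ℂ F w b).re := by
      filter_upwards [h1] with w hw
      rw [hw]; rfl
    rw [← e1, e2.fderiv_eq]
    have e3 := (h2.hasFDerivAt.clm_apply (hasFDerivAt_const b z)).restrictScalars ℝ
    have e4 := (Complex.reCLM.hasFDerivAt.comp z e3).fderiv
    have e5 : (fun w => (fderiv ℂ F w b).re) = Complex.reCLM ∘ fun w => fderiv ℂ F w b := rfl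
    rw [e5, e4]
    simp
  -- The second derivative of `F` is `ℂ`-bilinear, so its value at `(√-1 η, √-1 η)` is minus its
  -- value at `(η, η)`.
  rw [leviForm, h3, h3, map_smul, map_smul, _root_.smul_apply, smul_smul, Complex.I_mul_I]
  simp

/-- `log |c|²` is pluriharmonic where the holomorphic function `c` does not vanish. -/
theorem leviForm_log_norm_sq {n : ℕ} {c : (Fin n → ℂ) → ℂ} {z : Fin n → ℂ}
    (hc : ContDiffAt ℂ 2 c z) (h0 : c z ≠ 0) (η : Fin n → ℂ) :
    leviForm (fun w => Real.log (‖c w‖ ^ 2)) z η = 0 := by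
  -- Dividing by `c z` moves the value at `z` to `1`, where the principal logarithm is holomorphic.
  set F : (Fin n → ℂ) → ℂ := fun w => 2 * Complex.log (c w / c z) + 2 * Real.log ‖c z‖ with hF
  have hd : ContDiffAt ℂ 2 (fun w => c w / c z) z := hc.div_const _
  have hFc : ContDiffAt ℂ 2 F z := by
    refine (contDiffAt_const.mul (ContDiffAt.comp z (Complex.contDiffAt_log ?_) hd)).add
      contDiffAt_const
    rw [div_self h0]; exact Complex.one_mem_slitPlane
  have heq : (fun w => Real.log (‖c w‖ ^ 2)) =ᶠ[𝓝 z] fun w => (F w).re := by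
    filter_upwards [hc.continuousAt.eventually_ne h0] with w hw
    have h1 := norm_ne_zero_iff.mpr hw
    have h2 := norm_ne_zero_iff.mpr h0
    rw [Real.log_pow]
    simp [hF, Complex.log_re, Real.log_div h1 h2]
    ring
  rw [leviForm_congr heq, leviForm_re hFc]

theorem leviForm_continuousAt {n : ℕ} {f : (Fin n → ℂ) → ℝ} {z η : Fin n → ℂ}
    (hf : ContDiffAt ℝ 2 f z) :
    ContinuousAt (fun p : (Fin n → ℂ) × (Fin n → ℂ) => leviForm f p.1 p.2) (z, η) := by
  have hc : ContinuousAt (fderiv ℝ (fderiv ℝ f)) z := by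
    have h1 : ContDiffAt ℝ 1 (fderiv ℝ f) z := hf.fderiv_right (by norm_num)
    exact (h1.fderiv_right (m := 0) (by norm_num)).continuousAt
  have h1 : ContinuousAt (fun p : (Fin n → ℂ) × (Fin n → ℂ) => fderiv ℝ (fderiv ℝ f) p.1) (z, η) :=
    ContinuousAt.comp (f := Prod.fst) hc continuousAt_fst
  have h3 : ContinuousAt (fun p : (Fin n → ℂ) × (Fin n → ℂ) => Complex.I • p.2) (z, η) :=
    (by fun_prop : Continuous fun p : (Fin n → ℂ) × (Fin n → ℂ) => Complex.I • p.2).continuousAt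
  exact ((h1.clm_apply continuousAt_snd).clm_apply continuousAt_snd).add
    ((h1.clm_apply h3).clm_apply h3)

theorem leviForm_smul_vec {n : ℕ} (f : (Fin n → ℂ) → ℝ) (z η : Fin n → ℂ) (c : ℝ) :
    leviForm f z (c • η) = c ^ 2 * leviForm f z η := by
  rw [leviForm, smul_comm Complex.I c η]
  simp only [map_smul, _root_.smul_apply, smul_eq_mul, leviForm]
  ring

/-- A smooth real `(1,1)`-form `-√-1 ∂∂̄ f` is locally bounded by a multiple of any continuous
positive definite one. -/
theorem eventually_neg_leviForm_le {n : ℕ} {f : (Fin n → ℂ) → ℝ} {z : Fin n → ℂ}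
    (hf : ContDiffAt ℝ 2 f z) {A : (Fin n → ℂ) → Matrix (Fin n) (Fin n) ℂ}
    (hA : ContinuousAt A z) (hpos : (A z).PosDef) :
    ∃ C : ℝ, 0 < C ∧ ∀ᶠ w in 𝓝 z, ∀ ξ, -(1 / 4) * leviForm f w (star ξ) ≤ C * reForm (A w) ξ := by
  have hL : ∀ ξ, ContinuousAt (fun p : (Fin n → ℂ) × (Fin n → ℂ) =>
      -(1 / 4) * leviForm f p.1 (star p.2)) (z, ξ) := fun ξ => by
    refine continuousAt_const.mul ?_
    exact ContinuousAt.comp (f := fun p : (Fin n → ℂ) × (Fin n → ℂ) => (p.1, star p.2))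
      (leviForm_continuousAt hf) (by fun_prop)
  have hR : ∀ ξ, ContinuousAt (fun p : (Fin n → ℂ) × (Fin n → ℂ) =>
      reForm (A p.1) p.2) (z, ξ) := fun ξ => by
    have h1 : ContinuousAt (fun p : (Fin n → ℂ) × (Fin n → ℂ) => (A p.1, p.2)) (z, ξ) :=
      (ContinuousAt.comp (f := Prod.fst) hA continuousAt_fst).prodMk continuousAt_snd
    have h2 : Continuous fun q : Matrix (Fin n) (Fin n) ℂ × (Fin n → ℂ) => reForm q.1 q.2 := by
      unfold reForm
      refine Complex.continuous_re.comp ?_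
      exact continuous_snd.star.dotProduct (continuous_fst.matrix_mulVec continuous_snd)
    exact ContinuousAt.comp (f := fun p : (Fin n → ℂ) × (Fin n → ℂ) => (A p.1, p.2))
      h2.continuousAt h1
  -- Both sides are homogeneous of degree two in `ξ`, so the unit sphere suffices. The ratio is
  -- bounded there at `z`; the `+ 1` in the constant makes the inequality strict, and compactness
  -- keeps it true for all `w` near `z`.
  set K : Set (Fin n → ℂ) := Metric.sphere 0 1
  have hK : IsCompact K := isCompact_sphere 0 1
  have hne : ∀ ξ ∈ K, ξ ≠ 0 := fun ξ hξ h => by simp [K, h] at hξ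
  have hLz : Continuous fun ξ => -(1 / 4) * leviForm f z (star ξ) :=
    continuous_iff_continuousAt.mpr fun ξ =>
      ContinuousAt.comp (f := fun ξ => (z, ξ)) (hL ξ) (by fun_prop)
  have hRz : Continuous fun ξ => reForm (A z) ξ :=
    continuous_iff_continuousAt.mpr fun ξ =>
      ContinuousAt.comp (f := fun ξ => (z, ξ)) (hR ξ) (by fun_prop)
  obtain ⟨C, hC⟩ := hK.bddAbove_image (f := fun ξ =>
    -(1 / 4) * leviForm f z (star ξ) / reForm (A z) ξ)
    (hLz.continuousOn.div hRz.continuousOn fun ξ hξ => (reForm_pos hpos (hne ξ hξ)).ne')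
  refine ⟨max C 0 + 1, by positivity, ?_⟩
  have hev : ∀ᶠ w in 𝓝 z, ∀ ξ ∈ K,
      -(1 / 4) * leviForm f w (star ξ) < (max C 0 + 1) * reForm (A w) ξ := by
    refine hK.eventually_forall_of_forall_eventually fun ξ hξ => ?_
    refine (hL ξ).eventually_lt (continuousAt_const.mul (hR ξ)) ?_
    have hp := reForm_pos hpos (hne ξ hξ)
    have := (div_le_iff₀ hp).mp (hC ⟨ξ, hξ, rfl⟩)
    refine this.trans_lt ?_
    gcongr
    exact (le_max_left C 0).trans_lt (lt_add_one _)
  filter_upwards [hev] with w hw ξ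
  rcases eq_or_ne ξ 0 with rfl | hξ
  · simp [leviForm, reForm]
  · have hn : ‖ξ‖ ≠ 0 := norm_ne_zero_iff.mpr hξ
    have h1 : ξ = ‖ξ‖ • (‖ξ‖⁻¹ • ξ) := by rw [smul_smul, mul_inv_cancel₀ hn, one_smul]
    have h2 := hw (‖ξ‖⁻¹ • ξ) (by simp [K, norm_smul, hn])
    have h3 : star ξ = ‖ξ‖ • star (‖ξ‖⁻¹ • ξ) := by
      ext i; conv_lhs => rw [h1]
      simp
    rw [h3, leviForm_smul_vec]
    conv_rhs => rw [h1, reForm_smul_vec]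
    nlinarith [sq_nonneg ‖ξ‖, mul_le_mul_of_nonneg_left h2.le (sq_nonneg ‖ξ‖)]

/-! ### Propagation of upper bounds in time -/

/-- A function on `[a,b]` which grows at most linearly and has, at every point, a left difference
quotient of at most `ε`, grows with slope at most `ε`. -/
theorem le_add_mul_of_exists_left_slope_le {g : ℝ → ℝ} {a b K ε : ℝ} (hab : a ≤ b)
    (hK : ∀ x ∈ Set.Icc a b, ∀ y ∈ Set.Icc a b, x ≤ y → g y ≤ g x + K * (y - x))
    (hε : ∀ x ∈ Set.Ioc a b, ∃ y ∈ Set.Ico a x, g x ≤ g y + ε * (x - y)) :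
    g b ≤ g a + ε * (b - a) := by
  -- `A` consists of the points from which the desired bound reaches `b`. Its infimum `c` lies in
  -- `A`, because `hK` controls `g` at points of `A` decreasing to `c`; if `a < c`, a left step from
  -- `c` would give a smaller element.
  set A : Set ℝ := {x ∈ Set.Icc a b | g b ≤ g x + ε * (b - x)} with hA
  have hbA : b ∈ A := ⟨⟨hab, le_rfl⟩, by simp⟩
  have hbdd : BddBelow A := ⟨a, fun x hx => hx.1.1⟩
  set c := sInf A with hc
  have hac : a ≤ c := le_csInf ⟨b, hbA⟩ fun x hx => hx.1.1
  have hcb : c ≤ b := csInf_le hbdd hbA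
  have hcA : c ∈ A := by
    refine ⟨⟨hac, hcb⟩, ?_⟩
    obtain ⟨x, -, hxt, hxA⟩ := exists_seq_tendsto_sInf ⟨b, hbA⟩ hbdd
    have hlim : Filter.Tendsto (fun k => g c + K * (x k - c) + ε * (b - x k)) Filter.atTop
        (𝓝 (g c + K * (c - c) + ε * (b - c))) :=
      ((tendsto_const_nhds.add ((hxt.sub_const c).const_mul K)).add
        ((tendsto_const_nhds.sub hxt).const_mul ε))
    have := ge_of_tendsto' hlim fun k => (hxA k).2.trans
      (add_le_add_left (hK c ⟨hac, hcb⟩ (x k) (hxA k).1 (csInf_le hbdd (hxA k))) _)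
    simpa using this
  rcases hac.eq_or_lt with h | h
  · rw [h]; exact hcA.2
  · obtain ⟨y, hy, hle⟩ := hε c ⟨h, hcb⟩
    have hyA : y ∈ A := ⟨⟨hy.1, hy.2.le.trans hcb⟩, by linarith [hcA.2]⟩
    exact absurd (csInf_le hbdd hyA) (not_le.mpr hy.2)

theorem posDef_of_sub_smul_posSemidef {n : ℕ} {A B : Matrix (Fin n) (Fin n) ℂ} (hB : B.PosDef) {C : ℝ}
    (hC : 0 < C) (h : (A - ((C⁻¹ : ℝ) : ℂ) • B).PosSemidef) : A.PosDef := by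
  have h1 : (((C⁻¹ : ℝ) : ℂ) • B).PosDef :=
    hB.smul (Complex.zero_lt_real.mpr (inv_pos.mpr hC))
  simpa using h1.posSemidef_add h

theorem two_le_infty : (2 : WithTop ℕ∞) ≤ ∞ :=
  WithTop.coe_le_coe.2 (le_top : (2 : ℕ∞) ≤ ⊤)

/-! ### The norm of the defining section -/

section Bundles

variable {n : ℕ} {X : Type*} [TopologicalSpace X] [ChartedSpace (Fin n → ℂ) X]
  {L : X → Type*} [∀ x, AddCommGroup (L x)] [∀ x, Module ℂ (L x)]
  [∀ x, TopologicalSpace (L x)] [TopologicalSpace (Bundle.TotalSpace ℂ L)]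
  [FiberBundle ℂ L] [VectorBundle ℂ ℂ L]

theorem HermitianMetric.normSq_zero (h : HermitianMetric n L) (x : X) : h.normSq x 0 = 0 := by
  simpa using h.normSq_smul x 0 0

theorem HermitianMetric.normSq_nonneg (h : HermitianMetric n L) (x : X) (ξ : L x) :
    0 ≤ h.normSq x ξ := by
  rcases eq_or_ne ξ 0 with rfl | hξ
  · rw [h.normSq_zero]
  · exact (h.normSq_pos x ξ hξ).le

theorem trivialization_symm_one_ne_zero
    (τ : Bundle.Trivialization ℂ (Bundle.TotalSpace.proj : Bundle.TotalSpace ℂ L → X))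
    [MemTrivializationAtlas τ] {x : X} (hx : x ∈ τ.baseSet) : τ.symm x (1 : ℂ) ≠ 0 := by
  intro h0
  have h1 : τ.linearMapAt ℂ x (τ.symm x (1 : ℂ)) = 1 := τ.linearMapAt_symm hx 1
  rw [h0, map_zero] at h1
  exact zero_ne_one h1

theorem HermitianMetric.normSq_eq (h : HermitianMetric n L)
    (τ : Bundle.Trivialization ℂ (Bundle.TotalSpace.proj : Bundle.TotalSpace ℂ L → X))
    [MemTrivializationAtlas τ] {x : X} (hx : x ∈ τ.baseSet) (ξ : L x) :
    h.normSq x ξ = ‖(τ (Bundle.TotalSpace.mk' ℂ x ξ)).2‖ ^ 2 * h.normSq x (τ.symm x 1) := by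
  rw [← h.normSq_smul]
  congr 1
  have h1 : τ.linearMapAt ℂ x ξ = (τ (Bundle.TotalSpace.mk' ℂ x ξ)).2 := by
    rw [τ.coe_linearMapAt_of_mem hx]
  rw [← h1, ← τ.symmₗ_apply (R := ℂ) hx, ← map_smul, smul_eq_mul, mul_one, τ.symmₗ_linearMapAt hx]

theorem HermitianMetric.contDiffAt_frame (h : HermitianMetric n L)
    {e : OpenPartialHomeomorph X (Fin n → ℂ)} (he : e ∈ atlas (Fin n → ℂ) X)
    (τ : Bundle.Trivialization ℂ (Bundle.TotalSpace.proj : Bundle.TotalSpace ℂ L → X))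
    [MemTrivializationAtlas τ] {z : Fin n → ℂ} (hz : z ∈ e.target) (hzτ : e.symm z ∈ τ.baseSet) :
    ContDiffAt ℝ ∞ (fun w => h.normSq (e.symm w) (τ.symm (e.symm w) 1)) z :=
  (h.smooth e he τ).contDiffAt
    ((e.isOpen_inter_preimage_symm τ.open_baseSet).mem_nhds ⟨hz, hzτ⟩)

theorem IsDefiningSection.normSq_pos_iff {s : ∀ x, L x} {D : Set X}
    (hs : IsDefiningSection n s D) (h : HermitianMetric n L) (x : X) :
    0 < h.normSq x (s x) ↔ x ∉ D := by
  rw [hs.2.1 x]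
  refine ⟨fun hpos h0 => ?_, h.normSq_pos x _⟩
  rw [h0, h.normSq_zero] at hpos
  exact lt_irrefl _ hpos

/-- A smooth divisor has dense complement. -/
theorem IsDefiningSection.dense_compl {s : ∀ x, L x} {D : Set X}
    (hs : IsDefiningSection n s D) : Dense Dᶜ := by
  intro p
  by_cases hp : p ∉ D
  · exact subset_closure hp
  rw [not_not] at hp
  by_contra hcl
  set e := chartAt (Fin n → ℂ) p
  set τ := trivializationAt ℂ L p
  have hsrc : p ∈ e.source := mem_chart_source _ p
  have hD : ∀ᶠ x in 𝓝 p, x ∈ D := by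
    rw [mem_closure_iff_frequently] at hcl
    simpa using hcl
  have hτ : ∀ᶠ x in 𝓝 p, x ∈ τ.baseSet :=
    τ.open_baseSet.mem_nhds (FiberBundle.mem_baseSet_trivializationAt' p)
  have ht : Filter.Tendsto e.symm (𝓝 (e p)) (𝓝 p) := by
    simpa [e.left_inv hsrc] using (e.continuousAt_symm (e.map_source hsrc)).tendsto
  refine hs.2.2 p hp ?_
  -- If `D` contained a neighbourhood of `p`, the coefficient of `s` would vanish identically near
  -- `p`, contradicting transversality.
  have heq : (fun z => (τ (Bundle.TotalSpace.mk' ℂ (e.symm z) (s (e.symm z)))).2)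
      =ᶠ[𝓝 (e p)] fun _ => 0 := by
    filter_upwards [ht.eventually hD, ht.eventually hτ] with z h1 h2
    have h3 := τ.zeroSection ℂ h2
    rw [(hs.2.1 _).mp h1]
    exact congrArg Prod.snd h3
  rw [heq.fderiv_eq]
  simp

/-- The barrier `log |s|² - c |s|^{2γ}`, which tends to `-∞` along `D`. -/
noncomputable def barrier (h : HermitianMetric n L) (s : ∀ x, L x) (γ c : ℝ) (x : X) : ℝ :=
  Real.log (h.normSq x (s x)) - c * h.normSq x (s x) ^ γ

/-- Follows from `log x ≤ x`, which also holds on `D` because `Real.log 0 = 0`. -/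
theorem barrier_le_normSq (h : HermitianMetric n L) (s : ∀ x, L x) (γ : ℝ) {c : ℝ} (hc : 0 ≤ c)
    (x : X) : barrier h s γ c x ≤ h.normSq x (s x) := by
  have h0 := h.normSq_nonneg x (s x)
  have h1 := Real.log_le_self h0
  have h2 := mul_nonneg hc (Real.rpow_nonneg h0 γ)
  rw [barrier]; linarith

/-- If `ω_{γt} + √-1 ∂∂̄ u ≤ c (ω_{γt} + √-1 ∂∂̄ v)` at a point then `∂(u - v)/∂t ≤ n log c` there. -/
theorem deriv_sub_le_of_potentialForm_le {ωK η : RealOneOneForm n X} (hωK : ωK.IsKahler)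
    {D : Set X} {h : HermitianMetric n L} {s : ∀ x, L x} {α γ k T : ℝ} {hγ : X → ℝ}
    {u₀ v₀ : X → ℝ} {u v : ℝ → X → ℝ} (hu : IsSubsolution ωK η D h s hγ α γ k T u₀ u)
    (hv : IsSupersolution ωK η D h s hγ α γ k T v₀ v) {t : ℝ} (ht : t ∈ Set.Ioo 0 T)
    {e : OpenPartialHomeomorph X (Fin n → ℂ)} (he : e ∈ atlas (Fin n → ℂ) X) {x : X}
    (hx : x ∈ e.source) (hxD : x ∉ D) {c : ℝ} (hc : 0 < c)
    (hU : (potentialForm ωK η h hγ γ t (u t) e (e x)).PosDef)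
    (hV : (potentialForm ωK η h hγ γ t (v t) e (e x)).PosDef)
    (hle : ((c : ℂ) • potentialForm ωK η h hγ γ t (v t) e (e x) -
      potentialForm ωK η h hγ γ t (u t) e (e x)).PosSemidef) :
    deriv (fun τ => u τ x - v τ x) t ≤ n * Real.log c := by
  have hz := e.map_source hx
  have hzD : e.symm (e x) ∉ D := by rwa [e.left_inv hx]
  have h1 := hu.2 t ht e he _ hz hzD
  have h2 := hv.2 t ht e he _ hz hzD
  have h3 := log_det_sub_log_det_le hU hV (hωK.2 e he _ hz) hc hle
  rw [deriv_fun_sub (hu.1.time_diff t ht x hxD) (hv.1.time_diff t ht x hxD)]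
  -- The terms `h_γ` and `(1 - γ) log|s|²` are the same for `u` and `v` and cancel.
  simp only [mongeAmpereRHS, e.left_inv hx] at h1 h2
  linarith

variable [IsManifold 𝓘(ℂ, Fin n → ℂ) ω X] [ContMDiffVectorBundle ω ℂ L 𝓘(ℂ, Fin n → ℂ)]

/-- The coefficient of a holomorphic section with respect to a trivialization is holomorphic. -/
theorem IsDefiningSection.contDiffAt_coeff {s : ∀ x, L x} {D : Set X}
    (hs : IsDefiningSection n s D) {e : OpenPartialHomeomorph X (Fin n → ℂ)}
    (he : e ∈ atlas (Fin n → ℂ) X)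
    (τ : Bundle.Trivialization ℂ (Bundle.TotalSpace.proj : Bundle.TotalSpace ℂ L → X))
    [MemTrivializationAtlas τ] {z : Fin n → ℂ} (hz : z ∈ e.target) (hzτ : e.symm z ∈ τ.baseSet) :
    ContDiffAt ℂ ω (fun w => (τ (Bundle.TotalSpace.mk' ℂ (e.symm w) (s (e.symm w)))).2) z := by
  have h1 := (τ.contMDiffOn_section_baseSet_iff (IB := 𝓘(ℂ, Fin n → ℂ)) (n := ω)).mp
    (hs.1.contMDiffOn (s := τ.baseSet))
  have h2 := contMDiffOn_symm_of_mem_maximalAtlas (I := 𝓘(ℂ, Fin n → ℂ)) (n := ω)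
    (IsManifold.subset_maximalAtlas he)
  have h3 := (h1.contMDiffAt (τ.open_baseSet.mem_nhds hzτ)).comp z
    (h2.contMDiffAt (e.open_target.mem_nhds hz))
  exact h3.contDiffAt

theorem IsDefiningSection.contDiffAt_normSq {s : ∀ x, L x} {D : Set X}
    (hs : IsDefiningSection n s D) (h : HermitianMetric n L)
    {e : OpenPartialHomeomorph X (Fin n → ℂ)} (he : e ∈ atlas (Fin n → ℂ) X)
    {z : Fin n → ℂ} (hz : z ∈ e.target) :
    ContDiffAt ℝ ∞ (fun w => h.normSq (e.symm w) (s (e.symm w))) z := by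
  set τ := trivializationAt ℂ L (e.symm z)
  have hzτ : e.symm z ∈ τ.baseSet := FiberBundle.mem_baseSet_trivializationAt' _
  have hc := ((hs.contDiffAt_coeff he τ hz hzτ).restrict_scalars ℝ).of_le
    (le_top : (∞ : WithTop ℕ∞) ≤ ω)
  refine ((hc.norm_sq ℝ).mul (h.contDiffAt_frame he τ hz hzτ)).congr_of_eventuallyEq ?_
  filter_upwards [(e.isOpen_inter_preimage_symm τ.open_baseSet).mem_nhds ⟨hz, hzτ⟩] with w hw
  exact h.normSq_eq τ hw.2 _

theorem IsDefiningSection.continuous_normSq {s : ∀ x, L x} {D : Set X}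
    (hs : IsDefiningSection n s D) (h : HermitianMetric n L) :
    Continuous fun x => h.normSq x (s x) := by
  refine continuous_iff_continuousAt.mpr fun p => ?_
  set e := chartAt (Fin n → ℂ) p
  have hp : p ∈ e.source := mem_chart_source _ p
  have h1 := (hs.contDiffAt_normSq h (chart_mem_atlas _ p) (e.map_source hp)).continuousAt
  have h2 := ContinuousAt.comp (f := e) h1 (e.continuousAt hp)
  refine h2.congr ?_
  filter_upwards [e.open_source.mem_nhds hp] with x hx
  simp only [Function.comp_apply]
  rw [e.left_inv hx]

theorem IsDefiningSection.isOpen_compl {s : ∀ x, L x} {D : Set X}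
    (hs : IsDefiningSection n s D) (h : HermitianMetric n L) : IsOpen Dᶜ := by
  have : Dᶜ = {x | 0 < h.normSq x (s x)} := by
    ext x; exact (hs.normSq_pos_iff h x).symm
  rw [this]
  exact isOpen_lt continuous_const (hs.continuous_normSq h)

theorem IsDefiningSection.contDiffAt_log_normSq {s : ∀ x, L x} {D : Set X}
    (hs : IsDefiningSection n s D) (h : HermitianMetric n L)
    {e : OpenPartialHomeomorph X (Fin n → ℂ)} (he : e ∈ atlas (Fin n → ℂ) X)
    {z : Fin n → ℂ} (hz : z ∈ e.target) (hzD : e.symm z ∉ D) :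
    ContDiffAt ℝ 2 (fun w => Real.log (h.normSq (e.symm w) (s (e.symm w)))) z :=
  ((hs.contDiffAt_normSq h he hz).of_le two_le_infty).log
    ((hs.normSq_pos_iff h _).mpr hzD).ne'

theorem IsDefiningSection.contDiffAt_normSq_rpow {s : ∀ x, L x} {D : Set X}
    (hs : IsDefiningSection n s D) (h : HermitianMetric n L) (γ : ℝ)
    {e : OpenPartialHomeomorph X (Fin n → ℂ)} (he : e ∈ atlas (Fin n → ℂ) X)
    {z : Fin n → ℂ} (hz : z ∈ e.target) (hzD : e.symm z ∉ D) :
    ContDiffAt ℝ 2 (fun w => h.normSq (e.symm w) (s (e.symm w)) ^ γ) z :=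
  ((hs.contDiffAt_normSq h he hz).of_le two_le_infty).rpow_const_of_ne
    ((hs.normSq_pos_iff h _).mpr hzD).ne'

/-- `√-1 ∂∂̄ log |s|² = √-1 ∂∂̄ log |σ|²` off `D` for a local holomorphic frame `σ`. -/
theorem IsDefiningSection.leviForm_log_normSq {s : ∀ x, L x} {D : Set X}
    (hs : IsDefiningSection n s D) (h : HermitianMetric n L)
    {e : OpenPartialHomeomorph X (Fin n → ℂ)} (he : e ∈ atlas (Fin n → ℂ) X)
    (τ : Bundle.Trivialization ℂ (Bundle.TotalSpace.proj : Bundle.TotalSpace ℂ L → X))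
    [MemTrivializationAtlas τ] {z : Fin n → ℂ} (hz : z ∈ e.target)
    (hzτ : e.symm z ∈ τ.baseSet) (hzD : e.symm z ∉ D) (η : Fin n → ℂ) :
    leviForm (fun w => Real.log (h.normSq (e.symm w) (s (e.symm w)))) z η =
      leviForm (fun w => Real.log (h.normSq (e.symm w) (τ.symm (e.symm w) 1))) z η := by
  have hc := (hs.contDiffAt_coeff he τ hz hzτ).of_le (le_top : (2 : WithTop ℕ∞) ≤ ω)
  have hc0 : (τ (Bundle.TotalSpace.mk' ℂ (e.symm z) (s (e.symm z)))).2 ≠ 0 := fun h0 => by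
    have h1 := (hs.normSq_pos_iff h _).mpr hzD
    rw [h.normSq_eq τ hzτ, h0] at h1
    simp at h1
  have hframe : ∀ {w}, e.symm w ∈ τ.baseSet →
      h.normSq (e.symm w) (τ.symm (e.symm w) 1) ≠ 0 := fun hw =>
    (h.normSq_pos _ _ (trivialization_symm_one_ne_zero τ hw)).ne'
  -- With `s = cσ`, `log|s|² = log|c|² + log|σ|²`, and the first summand is pluriharmonic off `D`.
  have heq : (fun w => Real.log (h.normSq (e.symm w) (s (e.symm w)))) =ᶠ[𝓝 z] fun w =>
      Real.log (‖(τ (Bundle.TotalSpace.mk' ℂ (e.symm w) (s (e.symm w)))).2‖ ^ 2) +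
        Real.log (h.normSq (e.symm w) (τ.symm (e.symm w) 1)) := by
    filter_upwards [(e.isOpen_inter_preimage_symm τ.open_baseSet).mem_nhds ⟨hz, hzτ⟩,
      hc.continuousAt.eventually_ne hc0] with w hw hw0
    rw [h.normSq_eq τ hw.2, Real.log_mul _ (hframe hw.2)]
    exact pow_ne_zero _ (norm_ne_zero_iff.mpr hw0)
  rw [leviForm_congr heq, leviForm_add, leviForm_log_norm_sq hc hc0, zero_add]
  · refine ContDiffAt.log ((hc.restrict_scalars ℝ).norm_sq ℝ) ?_
    exact pow_ne_zero _ (norm_ne_zero_iff.mpr hc0)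
  · exact ((h.contDiffAt_frame he τ hz hzτ).of_le two_le_infty).log (hframe hzτ)

/-- The curvature is bounded by a multiple of a positive form on a compact manifold: every point
off `D` lies in a chart in which `-√-1 ∂∂̄ log |s|² ≤ C ωK` there. -/
theorem IsDefiningSection.exists_curvature_bound [CompactSpace X] {s : ∀ x, L x} {D : Set X}
    (hs : IsDefiningSection n s D) (h : HermitianMetric n L) {ωK : RealOneOneForm n X}
    (hωK : ωK.IsKahler) :
    ∃ C : ℝ, 0 < C ∧ ∀ x ∉ D, ∃ e ∈ atlas (Fin n → ℂ) X, x ∈ e.source ∧ ∀ ξ,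
      -(1 / 4) * leviForm (fun w => Real.log (h.normSq (e.symm w) (s (e.symm w)))) (e x) (star ξ)
        ≤ C * reForm (ωK.coeff e (e x)) ξ := by
  suffices H : ∃ C : ℝ, 0 < C ∧ ∀ x ∈ (Set.univ : Set X), x ∉ D →
      ∃ e ∈ atlas (Fin n → ℂ) X, x ∈ e.source ∧ ∀ ξ,
        -(1 / 4) * leviForm (fun w => Real.log (h.normSq (e.symm w) (s (e.symm w)))) (e x) (star ξ)
          ≤ C * reForm (ωK.coeff e (e x)) ξ by
    obtain ⟨C, hC, H⟩ := H
    exact ⟨C, hC, fun x => H x (Set.mem_univ x)⟩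
  -- The chart may depend on the point, so no change of charts is needed. On a union `C + C'` works,
  -- since the form of `ωK` is nonnegative.
  refine isCompact_univ.induction_on ⟨1, one_pos, by simp⟩ ?_ ?_ ?_
  · rintro s t hst ⟨C, hC, H⟩
    exact ⟨C, hC, fun x hx => H x (hst hx)⟩
  · rintro s t ⟨C, hC, H⟩ ⟨C', hC', H'⟩
    refine ⟨C + C', by positivity, ?_⟩
    rintro x (hx | hx) hxD
    · obtain ⟨e, he, hxe, hle⟩ := H x hx hxD
      refine ⟨e, he, hxe, fun ξ => (hle ξ).trans ?_⟩
      have := reForm_nonneg (hωK.2 e he _ (e.map_source hxe)).posSemidef ξ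
      nlinarith
    · obtain ⟨e, he, hxe, hle⟩ := H' x hx hxD
      refine ⟨e, he, hxe, fun ξ => (hle ξ).trans ?_⟩
      have := reForm_nonneg (hωK.2 e he _ (e.map_source hxe)).posSemidef ξ
      nlinarith
  · intro p _
    set e := chartAt (Fin n → ℂ) p
    set τ := trivializationAt ℂ L p
    have he : e ∈ atlas (Fin n → ℂ) X := chart_mem_atlas _ p
    have hp : p ∈ e.source := mem_chart_source _ p
    have hz := e.map_source hp
    have hpτ : p ∈ τ.baseSet := FiberBundle.mem_baseSet_trivializationAt' p
    have hzτ : e.symm (e p) ∈ τ.baseSet := by rwa [e.left_inv hp]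
    have hcont : ContinuousAt (ωK.coeff e) (e p) := by
      refine continuousAt_pi.mpr fun i => continuousAt_pi.mpr fun j => ?_
      exact ((ωK.smooth e he i j).contDiffAt (e.open_target.mem_nhds hz)).continuousAt
    have hlog : ContDiffAt ℝ 2
        (fun w => Real.log (h.normSq (e.symm w) (τ.symm (e.symm w) 1))) (e p) :=
      ((h.contDiffAt_frame he τ hz hzτ).of_le two_le_infty).log
        (h.normSq_pos _ _ (trivialization_symm_one_ne_zero τ hzτ)).ne'
    -- The bound is taken for `log|σ|²`, which is smooth across `D`; this makes it uniform up to
    -- `D`.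
    obtain ⟨C, hC, hev⟩ := eventually_neg_leviForm_le hlog hcont (hωK.2 e he _ hz)
    have hev' : ∀ᶠ x in 𝓝 p, x ∈ e.source ∧ x ∈ τ.baseSet ∧ ∀ ξ, -(1 / 4) * leviForm
        (fun w => Real.log (h.normSq (e.symm w) (τ.symm (e.symm w) 1))) (e x) (star ξ) ≤
          C * reForm (ωK.coeff e (e x)) ξ :=
      Filter.Eventually.and (e.open_source.mem_nhds hp) (Filter.Eventually.and
        (τ.open_baseSet.mem_nhds hpτ) ((e.continuousAt hp).eventually hev))
    refine ⟨_, mem_nhdsWithin_of_mem_nhds hev', C, hC, ?_⟩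
    rintro x ⟨hx, hxτ, hle⟩ hxD
    refine ⟨e, he, hx, fun ξ => ?_⟩
    rw [hs.leviForm_log_normSq h he τ (e.map_source hx) (by rwa [e.left_inv hx])
      (by rwa [e.left_inv hx])]
    exact hle ξ

/-! ### The barrier -/

theorem IsDefiningSection.contDiffAt_barrier {s : ∀ x, L x} {D : Set X}
    (hs : IsDefiningSection n s D) (h : HermitianMetric n L) (γ c : ℝ)
    {e : OpenPartialHomeomorph X (Fin n → ℂ)} (he : e ∈ atlas (Fin n → ℂ) X)
    {z : Fin n → ℂ} (hz : z ∈ e.target) (hzD : e.symm z ∉ D) :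
    ContDiffAt ℝ 2 (fun w => barrier h s γ c (e.symm w)) z :=
  (hs.contDiffAt_log_normSq h he hz hzD).sub
    (contDiffAt_const.mul (hs.contDiffAt_normSq_rpow h γ he hz hzD))

/-- If `-√-1 ∂∂̄ log |s|² ≤ C ωK` then `-√-1 ∂∂̄ (log |s|² - k C |s|^{2γ}) ≤ C ω_γ`. -/
theorem IsDefiningSection.neg_leviForm_barrier_le {s : ∀ x, L x} {D : Set X}
    (hs : IsDefiningSection n s D) (h : HermitianMetric n L) (ωK : RealOneOneForm n X) (γ k C : ℝ)
    {e : OpenPartialHomeomorph X (Fin n → ℂ)} (he : e ∈ atlas (Fin n → ℂ) X)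
    {z : Fin n → ℂ} (hz : z ∈ e.target) (hzD : e.symm z ∉ D) (ξ : Fin n → ℂ)
    (hle : -(1 / 4) * leviForm (fun w => Real.log (h.normSq (e.symm w) (s (e.symm w)))) z (star ξ)
      ≤ C * reForm (ωK.coeff e z) ξ) :
    -(1 / 4) * leviForm (fun w => barrier h s γ (k * C) (e.symm w)) z (star ξ)
      ≤ C * reForm (conicalForm ωK h s γ k e z) ξ := by
  have h1 := hs.contDiffAt_log_normSq h he hz hzD
  have h2 := hs.contDiffAt_normSq_rpow h γ he hz hzD
  have hb : (fun w => barrier h s γ (k * C) (e.symm w)) = fun w =>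
      Real.log (h.normSq (e.symm w) (s (e.symm w))) +
        -(k * C) * h.normSq (e.symm w) (s (e.symm w)) ^ γ := by
    ext w; rw [barrier]; ring
  rw [hb, leviForm_add h1 (contDiffAt_const.mul h2), leviForm_const_mul h2, conicalForm, reForm_add,
    reForm_smul, reForm_complexHessian h2]
  linarith

/-- For continuous `f` on a compact manifold, `f` plus a positive multiple of the barrier attains
its maximum over the complement of `D`. -/
theorem IsDefiningSection.exists_max_add_barrier [CompactSpace X] {s : ∀ x, L x} {D : Set X}
    (hs : IsDefiningSection n s D) (h : HermitianMetric n L) {γ a : ℝ} (hγ : 0 < γ) (ha : 0 < a)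
    (c : ℝ) {f : X → ℝ} (hf : Continuous f) (hne : Dᶜ.Nonempty) :
    ∃ x ∉ D, ∀ y ∉ D, f y + a * barrier h s γ c y ≤ f x + a * barrier h s γ c x := by
  set S : X → ℝ := fun x => h.normSq x (s x) with hS
  have hSc : Continuous S := hs.continuous_normSq h
  -- Exponentiated, the function extends continuously to `X` with value `0` on `D`. Its maximum over
  -- `X` is positive, hence attained off `D`.
  have hexp : ∀ x ∉ D, Real.exp (f x + a * barrier h s γ c x) =
      Real.exp (f x - a * c * S x ^ γ) * S x ^ a := fun x hx => by
    have hpos : 0 < S x := (hs.normSq_pos_iff h x).mpr hx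
    rw [Real.rpow_def_of_pos hpos a, ← Real.exp_add]
    congr 1
    rw [barrier]; simp only [hS]; ring
  have hcont : Continuous fun x => Real.exp (f x - a * c * S x ^ γ) * S x ^ a :=
    (Real.continuous_exp.comp (hf.sub (continuous_const.mul
      (hSc.rpow_const fun _ => Or.inr hγ.le)))).mul (hSc.rpow_const fun _ => Or.inr ha.le)
  obtain ⟨y₀, hy₀⟩ := hne
  obtain ⟨x, -, hx⟩ := isCompact_univ.exists_isMaxOn ⟨y₀, Set.mem_univ _⟩ hcont.continuousOn
  have hmax : ∀ y, Real.exp (f y - a * c * S y ^ γ) * S y ^ a ≤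
      Real.exp (f x - a * c * S x ^ γ) * S x ^ a := fun y => hx (Set.mem_univ y)
  have hxD : x ∉ D := fun hxD => by
    have h0 : S x = 0 := by simp only [hS]; rw [(hs.2.1 x).mp hxD, h.normSq_zero]
    have h1 := hmax y₀
    rw [← hexp y₀ hy₀, h0, Real.zero_rpow ha.ne', mul_zero] at h1
    exact absurd h1 (not_le.mpr (Real.exp_pos _))
  refine ⟨x, hxD, fun y hy => ?_⟩
  have h1 := hmax y
  rwa [← hexp y hy, ← hexp x hxD, Real.exp_le_exp] at h1

/-! ### Differential inequalities -/

/-- At a spatial maximum of `u - v + a ψ` off `D`, where `ψ` is the barrier,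
`ω_{γt} + √-1 ∂∂̄ u ≤ (1 + a C C') (ω_{γt} + √-1 ∂∂̄ v)`. -/
theorem IsDefiningSection.potentialForm_le_of_max {s : ∀ x, L x} {D : Set X}
    (hs : IsDefiningSection n s D) (h : HermitianMetric n L) (ωK η : RealOneOneForm n X)
    (hγ : X → ℝ) {γ k C C' t a : ℝ} (hC : 0 < C) (hC' : 0 < C') (ha : 0 < a)
    {f g : X → ℝ} (hf : SmoothOn n f Dᶜ) (hg : SmoothOn n g Dᶜ)
    {e : OpenPartialHomeomorph X (Fin n → ℂ)} (he : e ∈ atlas (Fin n → ℂ) X) {x : X}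
    (hx : x ∈ e.source) (hxD : x ∉ D)
    (hmax : ∀ y ∉ D, f y - g y + a * barrier h s γ (k * C) y ≤
      f x - g x + a * barrier h s γ (k * C) x)
    (hcurv : ∀ ξ, -(1 / 4) * leviForm (fun w => Real.log (h.normSq (e.symm w) (s (e.symm w))))
      (e x) (star ξ) ≤ C * reForm (ωK.coeff e (e x)) ξ)
    (hU : (potentialForm ωK η h hγ γ t f e (e x)).PosDef)
    (hV : (potentialForm ωK η h hγ γ t g e (e x)).PosDef)
    (hle : (potentialForm ωK η h hγ γ t g e (e x) -
      ((C'⁻¹ : ℝ) : ℂ) • conicalForm ωK h s γ k e (e x)).PosSemidef) :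
    (((1 + a * C * C' : ℝ) : ℂ) • potentialForm ωK η h hγ γ t g e (e x) -
      potentialForm ωK η h hγ γ t f e (e x)).PosSemidef := by
  have hz := e.map_source hx
  have hzD : e.symm (e x) ∉ D := by rwa [e.left_inv hx]
  have hopen := e.isOpen_inter_preimage_symm (hs.isOpen_compl h)
  have hnhds : e.target ∩ e.symm ⁻¹' Dᶜ ∈ 𝓝 (e x) := hopen.mem_nhds ⟨hz, hzD⟩
  have hf2 : ContDiffAt ℝ 2 (fun w => f (e.symm w)) (e x) :=
    ((hf e he).contDiffAt hnhds).of_le two_le_infty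
  have hg2 : ContDiffAt ℝ 2 (fun w => g (e.symm w)) (e x) :=
    ((hg e he).contDiffAt hnhds).of_le two_le_infty
  have hb2 := hs.contDiffAt_barrier h γ (k * C) he hz hzD
  refine posSemidef_of_reForm_nonneg ?_ fun ξ => ?_
  · refine IsHermitian.sub ?_ hU.1
    exact (hV.smul (Complex.zero_lt_real.mpr (by positivity : 0 < 1 + a * C * C'))).1
  · have hloc : IsLocalMax (fun w => (f (e.symm w) + (-1) * g (e.symm w)) +
        a * barrier h s γ (k * C) (e.symm w)) (e x) := by
      filter_upwards [hnhds] with w hw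
      simp only [e.left_inv hx]
      have := hmax _ hw.2
      linarith
    have hng := contDiffAt_const (c := (-1 : ℝ)) (n := 2) (x := e x) (𝕜 := ℝ) |>.mul hg2
    have hab := contDiffAt_const (c := a) (n := 2) (x := e x) (𝕜 := ℝ) |>.mul hb2
    have h1 := leviForm_nonpos_of_isLocalMax ((hf2.add hng).add hab) hloc (star ξ)
    rw [leviForm_add (hf2.add hng) hab, leviForm_add hf2 hng, leviForm_const_mul hg2,
      leviForm_const_mul hb2] at h1
    have h2 := hs.neg_leviForm_barrier_le h ωK γ k C he hz hzD ξ (hcurv ξ)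
    have h3 := reForm_nonneg hle ξ
    rw [reForm_sub, reForm_smul] at h3
    have h4 : reForm (conicalForm ωK h s γ k e (e x)) ξ ≤
        C' * reForm (potentialForm ωK η h hγ γ t g e (e x)) ξ := by
      have := mul_le_mul_of_nonneg_left h3 hC'.le
      rw [mul_zero, mul_sub, ← mul_assoc, mul_inv_cancel₀ hC'.ne', one_mul] at this
      linarith
    have h5 := mul_le_mul_of_nonneg_left h4 (mul_pos ha hC).le
    have h6 := mul_le_mul_of_nonneg_left h2 ha.le
    rw [reForm_sub, reForm_smul]
    have hUq : reForm (potentialForm ωK η h hγ γ t f e (e x)) ξ =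
        reForm (backgroundForm ωK η h hγ γ t e (e x)) ξ +
          1 / 4 * leviForm (fun w => f (e.symm w)) (e x) (star ξ) := by
      rw [potentialForm, reForm_add, reForm_complexHessian hf2]
    have hVq : reForm (potentialForm ωK η h hγ γ t g e (e x)) ξ =
        reForm (backgroundForm ωK η h hγ γ t e (e x)) ξ +
          1 / 4 * leviForm (fun w => g (e.symm w)) (e x) (star ξ) := by
      rw [potentialForm, reForm_add, reForm_complexHessian hg2]
    -- The background form cancels: `U - V = √-1 ∂∂̄(f - g) ≤ -a √-1 ∂∂̄ψ ≤ aCω_γ ≤ aCC'V`.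
    linarith

end Bundles

/-- Left difference quotients tend to the derivative, so one of them is below `ε`. This supplies the
left steps for `le_add_mul_of_exists_left_slope_le`. -/
theorem exists_left_le_of_deriv_lt {φ : ℝ → ℝ} {t a ε : ℝ} (hφ : DifferentiableAt ℝ φ t)
    (hat : a < t) (h : deriv φ t < ε) : ∃ y ∈ Set.Ico a t, φ t ≤ φ y + ε * (t - y) := by
  have h1 : Filter.Tendsto (slope φ t) (𝓝[<] t) (𝓝 (deriv φ t)) :=
    (hasDerivAt_iff_tendsto_slope.mp hφ.hasDerivAt).mono_left (nhdsLT_le_nhdsNE t)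
  have h2 := (h1.eventually_lt_const h).and (Ico_mem_nhdsLT hat)
  obtain ⟨y, hy, hyI⟩ := h2.exists
  refine ⟨y, hyI, ?_⟩
  rw [slope_comm, slope_def_field, div_lt_iff₀ (sub_pos.mpr hyI.2)] at hy
  linarith

end ConicalFlow

/-! ### The comparison principle -/

open ConicalFlow in
/-- Upper bounds for `u - v` propagate forward in time off the divisor. -/
theorem ConicalFlow.sub_le_of_initial_le
    {n : ℕ} {X : Type*} [TopologicalSpace X] [CompactSpace X]
    [ChartedSpace (Fin n → ℂ) X] [IsManifold 𝓘(ℂ, Fin n → ℂ) ω X]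
    {L : X → Type*} [∀ x, AddCommGroup (L x)] [∀ x, Module ℂ (L x)]
    [∀ x, TopologicalSpace (L x)] [TopologicalSpace (Bundle.TotalSpace ℂ L)]
    [FiberBundle ℂ L] [VectorBundle ℂ ℂ L]
    [ContMDiffVectorBundle ω ℂ L 𝓘(ℂ, Fin n → ℂ)]
    {ωK η : RealOneOneForm n X} (hωK : ωK.IsKahler)
    {D : Set X} {h : HermitianMetric n L} {s : ∀ x, L x}
    (hs : IsDefiningSection n s D)
    {α γ k T : ℝ} (hγ0 : 0 < γ) (hk : 0 < k)
    (hcone : ∀ e ∈ atlas (Fin n → ℂ) X, ∀ z ∈ e.target, e.symm z ∉ D →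
      (conicalForm ωK h s γ k e z).PosDef)
    {hγ : X → ℝ} {u₀ v₀ : X → ℝ} {u v : ℝ → X → ℝ}
    (hu : IsSubsolution ωK η D h s hγ α γ k T u₀ u)
    (hv : IsSupersolution ωK η D h s hγ α γ k T v₀ v)
    {t₀ t₁ M : ℝ} (ht₀ : 0 < t₀) (ht : t₀ < t₁) (ht₁ : t₁ < T)
    (hM : ∀ x, u t₀ x - v t₀ x ≤ M) {x₁ : X} (hx₁ : x₁ ∉ D) : u t₁ x₁ - v t₁ x₁ ≤ M := by
  obtain ⟨C₁, hC₁, hu1⟩ := hu.1.equivalent (t₀ / 2) ((t₁ + T) / 2) (by linarith) (by linarith)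
    (by linarith)
  obtain ⟨C₂, hC₂, hv1⟩ := hv.1.equivalent (t₀ / 2) ((t₁ + T) / 2) (by linarith) (by linarith)
    (by linarith)
  obtain ⟨C, hC, hcurv⟩ := hs.exists_curvature_bound h hωK
  have hIoo : ∀ t ∈ Set.Icc t₀ t₁, t ∈ Set.Ioo (t₀ / 2) ((t₁ + T) / 2) := fun t ht' =>
    ⟨by linarith [ht'.1], by linarith [ht'.2]⟩
  have hI : ∀ t ∈ Set.Icc t₀ t₁, t ∈ Set.Ioo 0 T := fun t ht' =>
    ⟨by linarith [ht'.1], by linarith [ht'.2]⟩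
  have hdiff : ∀ t ∈ Set.Icc t₀ t₁, ∀ x ∉ D, DifferentiableAt ℝ (fun τ => u τ x - v τ x) t :=
    fun t ht' x hx => (hu.1.time_diff t (hI t ht') x hx).sub (hv.1.time_diff t (hI t ht') x hx)
  have hposdef : ∀ t ∈ Set.Icc t₀ t₁, ∀ e ∈ atlas (Fin n → ℂ) X, ∀ z ∈ e.target, e.symm z ∉ D →
      (potentialForm ωK η h hγ γ t (u t) e z).PosDef ∧
        (potentialForm ωK η h hγ γ t (v t) e z).PosDef := fun t ht' e he z hz hzD =>
    ⟨posDef_of_sub_smul_posSemidef (hcone e he z hz hzD) hC₁ (hu1 t (hIoo t ht') e he z hz hzD).1,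
      posDef_of_sub_smul_posSemidef (hcone e he z hz hzD) hC₂ (hv1 t (hIoo t ht') e he z hz hzD).1⟩
  -- Crude growth bound at every point off `D`, not only at maxima: `U ≤ C₁ω_γ ≤ C₁C₂V`.
  have hK : ∀ t ∈ Set.Icc t₀ t₁, ∀ x ∉ D,
      deriv (fun τ => u τ x - v τ x) t ≤ n * Real.log (C₁ * C₂) := by
    intro t ht' x hx
    obtain ⟨e, he, hxe, -⟩ := hcurv x hx
    have hz := e.map_source hxe
    have hzD : e.symm (e x) ∉ D := by rwa [e.left_inv hxe]
    obtain ⟨hU, hV⟩ := hposdef t ht' e he _ hz hzD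
    refine deriv_sub_le_of_potentialForm_le hωK hu hv (hI t ht') he hxe hx (mul_pos hC₁ hC₂) hU hV ?_
    have h1 := (hu1 t (hIoo t ht') e he _ hz hzD).2
    have h2 := (hv1 t (hIoo t ht') e he _ hz hzD).1.smul
      (Complex.zero_le_real.mpr (mul_pos hC₁ hC₂).le)
    have h3 := h2.add h1
    have h4 : ((C₁ * C₂ : ℝ) : ℂ) * ((C₂⁻¹ : ℝ) : ℂ) = C₁ := by
      rw [← Complex.ofReal_mul, mul_assoc, mul_inv_cancel₀ hC₂.ne', mul_one]
    rwa [smul_sub, smul_smul, h4, sub_add_sub_cancel] at h3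
  have hgrowth : ∀ x ∉ D, ∀ a ∈ Set.Icc t₀ t₁, ∀ b ∈ Set.Icc t₀ t₁, a ≤ b →
      u b x - v b x ≤ u a x - v a x + n * Real.log (C₁ * C₂) * (b - a) := by
    intro x hx a ha b hb hab
    have := (convex_Icc t₀ t₁).image_sub_le_mul_sub_of_deriv_le (f := fun τ => u τ x - v τ x)
      (fun t ht' => (hdiff t ht' x hx).continuousAt.continuousWithinAt)
      (fun t ht' => (hdiff t (interior_subset ht') x hx).differentiableWithinAt)
      (fun t ht' => hK t (interior_subset ht') x hx) a ha b hb hab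
    linarith
  obtain ⟨B, hB⟩ := (isCompact_range (hs.continuous_normSq h)).bddAbove
  have hbound : ∀ a : ℝ, 0 < a → u t₁ x₁ - v t₁ x₁ ≤ M + a *
      (B - barrier h s γ (k * C) x₁ + (n * (C * C₂) + 1) * (t₁ - t₀)) := by
    intro a ha
    have hcont : ∀ t ∈ Set.Icc t₀ t₁, Continuous fun x => u t x - v t x := fun t ht' =>
      (hu.1.regular t (hI t ht')).1.1.sub (hv.1.regular t (hI t ht')).1.1
    have hex : ∀ t, ∃ x ∉ D, t ∈ Set.Icc t₀ t₁ → ∀ y ∉ D,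
        u t y - v t y + a * barrier h s γ (k * C) y ≤
          u t x - v t x + a * barrier h s γ (k * C) x := fun t => by
      by_cases ht' : t ∈ Set.Icc t₀ t₁
      · obtain ⟨x, hx, hmax⟩ := hs.exists_max_add_barrier h hγ0 ha (k * C) (hcont t ht')
          ⟨x₁, hx₁⟩
        exact ⟨x, hx, fun _ => hmax⟩
      · exact ⟨x₁, hx₁, fun h' => absurd h' ht'⟩
    choose p hpD hp using hex
    -- At `p t` the time derivative is at most `a * (n * (C * C₂))`; the extra `a` in `ε` makes this
    -- strict. Both hypotheses compare two times at the later maximum point, whose value at the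
    -- earlier time is at most the earlier maximum.
    have hmain := le_add_mul_of_exists_left_slope_le
      (g := fun t => u t (p t) - v t (p t) + a * barrier h s γ (k * C) (p t))
      (K := n * Real.log (C₁ * C₂)) (ε := a * (n * (C * C₂) + 1)) ht.le ?_ ?_
    · have h1 := hp t₁ ⟨ht.le, le_rfl⟩ x₁ hx₁
      have h2 := hM (p t₀)
      have h3 := (barrier_le_normSq h s γ (mul_pos hk hC).le (p t₀)).trans (hB ⟨p t₀, rfl⟩)
      have h4 := mul_le_mul_of_nonneg_left h3 ha.le
      linarith
    · intro a' ha' b hb hab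
      have h1 := hgrowth (p b) (hpD b) a' ha' b hb hab
      have h2 := hp a' ha' (p b) (hpD b)
      linarith
    · intro t ht'
      have htI : t ∈ Set.Icc t₀ t₁ := ⟨ht'.1.le, ht'.2⟩
      obtain ⟨e, he, hxe, hξ⟩ := hcurv (p t) (hpD t)
      have hz := e.map_source hxe
      have hzD : e.symm (e (p t)) ∉ D := by rw [e.left_inv hxe]; exact hpD t
      obtain ⟨hU, hV⟩ := hposdef t htI e he _ hz hzD
      have hpos : 0 < 1 + a * C * C₂ := by positivity
      have hle := hs.potentialForm_le_of_max h ωK η hγ hC hC₂ ha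
        (hu.1.regular t (hI t htI)).2 (hv.1.regular t (hI t htI)).2 he hxe (hpD t) (hp t htI) hξ
        hU hV (hv1 t (hIoo t htI) e he _ hz hzD).1
      have hd := deriv_sub_le_of_potentialForm_le hωK hu hv (hI t htI) he hxe (hpD t) hpos hU hV hle
      have hlog : Real.log (1 + a * C * C₂) ≤ a * C * C₂ := by
        linarith [Real.log_le_sub_one_of_pos hpos]
      have hlt : deriv (fun τ => u τ (p t) - v τ (p t)) t < a * (n * (C * C₂) + 1) := by
        have := mul_le_mul_of_nonneg_left hlog (Nat.cast_nonneg (α := ℝ) n)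
        linarith
      obtain ⟨y, hy, hle'⟩ := exists_left_le_of_deriv_lt (hdiff t htI _ (hpD t)) ht'.1 hlt
      refine ⟨y, hy, ?_⟩
      have h2 := hp y ⟨hy.1, hy.2.le.trans ht'.2⟩ (p t) (hpD t)
      linarith
  -- `Q` does not depend on `a`, so the error `a * Q` disappears as `a → 0`.
  set Q := B - barrier h s γ (k * C) x₁ + (n * (C * C₂) + 1) * (t₁ - t₀)
  have hlim : Filter.Tendsto (fun a : ℝ => M + a * Q) (𝓝[>] 0) (𝓝 M) := by
    have : Filter.Tendsto (fun a : ℝ => M + a * Q) (𝓝 0) (𝓝 (M + 0 * Q)) :=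
      tendsto_const_nhds.add (Filter.tendsto_id.mul_const Q)
    rw [zero_mul, add_zero] at this
    exact this.mono_left nhdsWithin_le_nhds
  exact ge_of_tendsto hlim (by filter_upwards [self_mem_nhdsWithin] with a ha using hbound a ha)

theorem proposition0313003
    {n : ℕ} {X : Type*} [TopologicalSpace X] [T2Space X] [CompactSpace X]
    [ChartedSpace (Fin n → ℂ) X] [IsManifold 𝓘(ℂ, Fin n → ℂ) ω X]
    {L : X → Type*} [∀ x, AddCommGroup (L x)] [∀ x, Module ℂ (L x)]
    [∀ x, TopologicalSpace (L x)] [TopologicalSpace (Bundle.TotalSpace ℂ L)]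
    [FiberBundle ℂ L] [VectorBundle ℂ ℂ L]
    [ContMDiffVectorBundle ω ℂ L 𝓘(ℂ, Fin n → ℂ)]
    (ωK η : ConicalFlow.RealOneOneForm n X) (hωK : ωK.IsKahler) (hη : η.IsClosed)
    (D : Set X) (h : ConicalFlow.HermitianMetric n L) (s : ∀ x, L x)
    (hs : ConicalFlow.IsDefiningSection n s D)
    (α γ k T : ℝ) (hα : 0 < α ∧ α < 1) (hγ01 : 0 < γ ∧ γ ≤ 1) (hT : 0 < T)
    (hk : 0 < k)
    (hcone : ∀ e ∈ atlas (Fin n → ℂ) X, ∀ z ∈ e.target, e.symm z ∉ D →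
      (ConicalFlow.conicalForm ωK h s γ k e z).PosDef)
    (hγ : X → ℝ) (hγ_smooth : ConicalFlow.SmoothOn n hγ Set.univ)
    (hbackground : ∀ t ∈ Set.Icc 0 T, ∀ e ∈ atlas (Fin n → ℂ) X, ∀ z ∈ e.target,
      (ConicalFlow.backgroundForm ωK η h hγ γ t e z).PosDef)
    (u₀ v₀ : X → ℝ) (u v : ℝ → X → ℝ)
    (hu : ConicalFlow.IsSubsolution ωK η D h s hγ α γ k T u₀ u)
    (hv : ConicalFlow.IsSupersolution ωK η D h s hγ α γ k T v₀ v) :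
    ∀ t ∈ Set.Ioo 0 T, ∀ x : X, u t x - v t x ≤ ⨆ y : X, (u₀ y - v₀ y) := by
  intro t ht
  set M := ⨆ y : X, (u₀ y - v₀ y) with hM
  have hcont₀ : Continuous fun y => u₀ y - v₀ y := hu.1.initial_psh.1.sub hv.1.initial_psh.1
  have hle₀ : ∀ y, u₀ y - v₀ y ≤ M := fun y => le_ciSup (isCompact_range hcont₀).bddAbove y
  have hoff : ∀ x ∉ D, u t x - v t x ≤ M := by
    intro x hx
    refine le_of_forall_pos_le_add fun ε hε => ?_
    have h1 := Metric.tendstoUniformly_iff.mp hu.1.initial (ε / 2) (half_pos hε)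
    have h2 := Metric.tendstoUniformly_iff.mp hv.1.initial (ε / 2) (half_pos hε)
    -- At a small time `t₀ < t` both functions are within `ε / 2` of their initial values, so `u - v
    -- ≤ M + ε` there, and this bound propagates to `t`.
    obtain ⟨t₀, ⟨h1', h2'⟩, ht₀⟩ := ((h1.and h2).and (Ioo_mem_nhdsGT ht.1)).exists
    refine ConicalFlow.sub_le_of_initial_le hωK hs hγ01.1 hk hcone hu hv ht₀.1 ht₀.2 ht.2
      (fun y => ?_) hx
    have a1 := abs_lt.mp (h1' y)
    have a2 := abs_lt.mp (h2' y)
    linarith [hle₀ y]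
  -- The estimate is a closed condition on `x` and holds on the dense complement of `D`.
  have hclosed : IsClosed {x | u t x - v t x ≤ M} :=
    isClosed_le ((hu.1.regular t ht).1.1.sub (hv.1.regular t ht).1.1) continuous_const
  intro x
  exact hclosed.closure_subset_iff.mpr (fun y hy => hoff y hy) (hs.dense_compl x)
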